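/- For an integer $s\ge 1$ (the number of servers) and $\delta\le\sqrt s$ put $$f_s(\delta)=\sqrt s\,\Bigl(1-\frac{\delta}{\sqrt s}\Bigr)B(s,s-\delta\sqrt s),\qquad B(s,\lambda)=\frac{\lambda^s/s!}{\sum_{k=0}^{s}\lambda^k/k!},$$ where $B$ is the Erlang B formula. For $0<\gamma<\sqrt s$ let $a_s(\gamma)$ be the solution $a$ (with $\gamma-a\le\sqrt s$) of the Cohen equation $a=f_s(\gamma-a)$, which exists and is unique, and let $$L_s(\gamma)=\frac{(\sqrt s-\gamma)^2}{\sqrt s-\gamma+a_s(\gamma)},\qquad 0<\gamma<\sqrt s .$$ For $\gamma>0$ let $a_\infty(\gamma)$ be the solution, which exists and is unique, of $a=\varphi(\gamma-a)/\Phi(\gamma-a)$, where $\varphi$ and $\Phi$ are the standard normal density and distribution function. **Theorem.** For every integer $s\ge1$ the function $L_s$ has a unique maximizer $\hat\gamma_s$ on $(0,\sqrt s)$. The sequence $\hat\gamma_s$ increases strictly in $s\ge 1$, from $\hat\gamma_1=1/2$ to the limit $\hat\gamma_\infty=1.034113459\ldots$ as $s\to\infty$ (that is, $1.034113459\le\hat\gamma_\infty<1.034113460$).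 The function $\gamma\,a_\infty(\gamma)$ decreases strictly on $(0,\infty)$, with limit $1$ as $\gamma\downarrow0$ and limit $0$ as $\gamma\to\infty$, and $\hat\gamma_\infty$ is the unique root $\gamma>0$ of $\gamma\,a_\infty(\gamma)=\tfrac12$. -/

import Mathlib

open Set Filter Topology

noncomputable section

/-- The Erlang B formula `B(s,λ) = (λ^s/s!) / ∑_{k=0}^s λ^k/k!`. -/
def erlangB (s : ℕ) (l : ℝ) : ℝ :=
  (l ^ s / (s.factorial : ℝ)) / ∑ k ∈ Finset.range (s + 1), l ^ k / (k.factorial : ℝ)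

/-- `f_s(δ) = √s (1 - δ/√s) B(s, s - δ√s)`, of interest for `δ ≤ √s`. -/
def fErlang (s : ℕ) (δ : ℝ) : ℝ :=
  √(s : ℝ) * (1 - δ / √(s : ℝ)) * erlangB s ((s : ℝ) - δ * √(s : ℝ))

/-- `a` solves the Cohen equation `a = f_s(γ - a)`, the argument `γ - a` being in the domain
`(-∞, √s]` of `f_s` (equivalently, the total arrival rate `s - (γ - a)√s` is nonnegative). -/
def IsCohenSol (s : ℕ) (γ a : ℝ) : Prop :=
  γ - a ≤ √(s : ℝ) ∧ a = fErlang s (γ - a)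

/-- `a_s(γ)`, the solution of the Cohen equation. -/
def cohenA (s : ℕ) (γ : ℝ) : ℝ :=
  Classical.epsilon (IsCohenSol s γ)

/-- The normalized carried traffic `L_s(γ) = (√s - γ)² / (√s - γ + a_s(γ))`, `0 < γ < √s`. -/
def carriedL (s : ℕ) (γ : ℝ) : ℝ :=
  (√(s : ℝ) - γ) ^ 2 / (√(s : ℝ) - γ + cohenA s γ)

/-- `γ` is a maximizer of `L_s` on the open interval `(0, √s)`. -/
def IsMaximizerL (s : ℕ) (γ : ℝ) : Prop :=
  γ ∈ Ioo (0 : ℝ) (√(s : ℝ)) ∧ IsMaxOn (carriedL s) (Ioo (0 : ℝ) (√(s : ℝ))) γ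

/-- `γ̂_s`, the maximizer of `L_s` on `(0, √s)`. -/
def gammaHat (s : ℕ) : ℝ :=
  Classical.epsilon (IsMaximizerL s)

/-- `f_∞(δ) = φ(δ)/Φ(δ)`, with the standard normal density and distribution function. -/
def fInfty (δ : ℝ) : ℝ :=
  ProbabilityTheory.gaussianPDFReal 0 1 δ /
    ProbabilityTheory.cdf (ProbabilityTheory.gaussianReal 0 1) δ

/-- `a_∞(γ)`, the solution of the limiting Cohen equation `a = f_∞(γ - a)`. -/
def cohenAInfty (γ : ℝ) : ℝ :=
  Classical.epsilon fun a : ℝ => a = fInfty (γ - a)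

end

/-!
Write `R = 1 / B(s, L)`, where `L` is the total arrival rate. Along the solutions of the Cohen
equation `γ √s` is the mean number `N = s - L (1 - 1 / R)` of idle servers, which decreases in `L`,
and `L_s = L (1 - 1 / R)² / √s`. The derivative of `L (1 - 1 / R)²` has the sign of
`1 / 2 - N / (R - 1)`, and `N / (R - 1)` increases from `0` to `1`, because its derivative is a
positive multiple of a function that decreases to `0` at infinity. So there is a unique maximizer,
and `γ < γ̂_s` holds exactly if `R < 1 + 2 γ √s` at the critical rate `(s - c) (1 + 2 c) / (2 c)`,
where `c = γ √s`. In particular equality holds at `γ = γ̂_s`.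

If the criterion for `s + 1` servers failed at `γ = γ̂_s`, the recursion of `R` in `s` would bound
`R(s, ·)` from below at the critical rate for `s + 1`. Since the Taylor coefficients of
`R(s, L - h)` in `h` are nonnegative, the cubic Taylor polynomial carries this bound to the critical
rate for `s`, where it contradicts the equality; what has to be checked is a polynomial inequality,
true for `γ ≥ 3 / 5`.

As `s → ∞`, `R(s, s - d √s) / √s` tends to the Mills ratio `Φ(d) / φ(d)`, and the criterion turns
into `γ a_∞(γ) = 1 / 2`. The product `γ a_∞(γ)` is one minus the variance of that truncation to
`(0, ∞)` of a unit-variance normal law which has mean `γ`; it is monotone because the third cumulant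
of such a truncation is positive.
-/

/-! ### The Erlang B formula -/

section Erlang

variable {s : ℕ} {L : ℝ}

/-- The reciprocal `1 / B(s, L)` of the Erlang B formula, by its classical recursion in `s`. -/
noncomputable def invErlangB : ℕ → ℝ → ℝ
  | 0, _ => 1
  | s + 1, L => 1 + (s + 1) / L * invErlangB s L

theorem invErlangB_zero (L : ℝ) : invErlangB 0 L = 1 := rfl

theorem invErlangB_succ (s : ℕ) (L : ℝ) :
    invErlangB (s + 1) L = 1 + (s + 1) / L * invErlangB s L := rfl

theorem one_le_invErlangB (s : ℕ) (hL : 0 < L) : 1 ≤ invErlangB s L := by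
  induction s with
  | zero => exact le_rfl
  | succ s ih => rw [invErlangB_succ, le_add_iff_nonneg_right]; positivity

theorem invErlangB_pos (s : ℕ) (hL : 0 < L) : 0 < invErlangB s L :=
  one_pos.trans_le (one_le_invErlangB s hL)

theorem one_lt_invErlangB (hs : 1 ≤ s) (hL : 0 < L) : 1 < invErlangB s L := by
  obtain ⟨k, rfl⟩ := Nat.exists_eq_add_of_le' hs
  have := invErlangB_pos k hL
  rw [invErlangB_succ, lt_add_iff_pos_right]
  positivity

theorem invErlangB_eq_sum_descFactorial (s : ℕ) (L : ℝ) :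
    invErlangB s L = ∑ k ∈ Finset.range (s + 1), (s.descFactorial k : ℝ) / L ^ k := by
  induction s with
  | zero => simp [invErlangB_zero]
  | succ s ih =>
    rw [Finset.sum_range_succ', invErlangB_succ, ih, Finset.mul_sum, add_comm]
    congr 1
    · refine Finset.sum_congr rfl fun k _ ↦ ?_
      rw [Nat.succ_descFactorial_succ, div_mul_div_comm, pow_succ']
      push_cast
      rfl
    · simp

theorem erlangB_eq_inv_invErlangB (s : ℕ) (hL : 0 < L) : erlangB s L = (invErlangB s L)⁻¹ := by
  have hterm : ∀ k ∈ Finset.range (s + 1),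
      L ^ s / (s.factorial : ℝ) * ((s.descFactorial k : ℝ) / L ^ k) =
        L ^ (s - k) / ((s - k).factorial : ℝ) := by
    intro k hk
    have hks : k ≤ s := Finset.mem_range_succ_iff.1 hk
    rw [← Nat.factorial_mul_descFactorial hks, ← pow_sub_mul_pow L hks]
    have := (Nat.descFactorial_pos.2 hks).ne'
    push_cast
    field_simp
  rw [erlangB, ← Finset.sum_range_reflect, invErlangB_eq_sum_descFactorial]
  simp only [Nat.add_sub_cancel]
  rw [← Finset.sum_congr rfl hterm, ← Finset.mul_sum, div_mul_cancel_left₀ (by positivity)]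

theorem tendsto_invErlangB_atTop (s : ℕ) : Tendsto (invErlangB s) atTop (𝓝 1) := by
  induction s with
  | zero => exact tendsto_const_nhds
  | succ s ih =>
    simpa [invErlangB] using
      (((tendsto_const_nhds (x := (s : ℝ) + 1)).div_atTop tendsto_id).mul ih).const_add 1

/-- The mean number `s - L (1 - B(s, L))` of idle servers. -/
noncomputable def meanIdle (s : ℕ) (L : ℝ) : ℝ := s - L + L / invErlangB s L

theorem meanIdle_zero (L : ℝ) : meanIdle 0 L = 0 := by simp [meanIdle, invErlangB]

theorem meanIdle_succ_eq_div (s : ℕ) (hL : 0 < L) :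
    meanIdle (s + 1) L = (s + 1) * (1 + meanIdle s L) * invErlangB s L /
      (L * invErlangB (s + 1) L) := by
  have := invErlangB_pos s hL
  have : 0 < L + (s + 1) * invErlangB s L := by positivity
  rw [meanIdle, meanIdle, invErlangB_succ]
  push_cast
  field_simp
  ring

theorem meanIdle_nonneg (s : ℕ) (hL : 0 < L) : 0 ≤ meanIdle s L := by
  induction s with
  | zero => rw [meanIdle_zero]
  | succ s ih =>
    have := invErlangB_pos s hL
    have := invErlangB_pos (s + 1) hL
    rw [meanIdle_succ_eq_div s hL]
    positivity

theorem meanIdle_succ (s : ℕ) (hL : 0 < L) :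
    meanIdle (s + 1) L = (s + 1) * (1 + meanIdle s L) / (L + 1 + meanIdle s L) := by
  have hR := invErlangB_pos s hL
  have hN := meanIdle_nonneg s hL
  have hden : L * invErlangB (s + 1) L = (L + 1 + meanIdle s L) * invErlangB s L := by
    rw [invErlangB_succ, meanIdle]
    field_simp
    ring
  rw [meanIdle_succ_eq_div s hL, hden]
  field_simp

theorem meanIdle_pos (hs : 1 ≤ s) (hL : 0 < L) : 0 < meanIdle s L := by
  obtain ⟨k, rfl⟩ := Nat.exists_eq_add_of_le' hs
  rw [meanIdle_succ k hL]
  have := meanIdle_nonneg k hL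
  positivity

theorem meanIdle_lt_succ (s : ℕ) (hL : 0 < L) : meanIdle s L < meanIdle (s + 1) L := by
  induction s with
  | zero => rw [meanIdle_zero]; exact meanIdle_pos le_rfl hL
  | succ s ih =>
    have hNs := meanIdle_nonneg s hL
    have hNs' := meanIdle_nonneg (s + 1) hL
    rw [meanIdle_succ (s + 1) hL]
    nth_rewrite 1 [meanIdle_succ s hL]
    rw [div_lt_div_iff₀ (by positivity) (by positivity), ← sub_pos]
    have : 0 < meanIdle (s + 1) L - meanIdle s L := sub_pos.2 ih
    calc (0 : ℝ) < (s + 1) * (L * (meanIdle (s + 1) L - meanIdle s L)) +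
          (1 + meanIdle (s + 1) L) * (L + 1 + meanIdle s L) := by positivity
      _ = _ := by push_cast; ring

theorem meanIdle_lt (hs : 1 ≤ s) (hL : 0 < L) : meanIdle s L < s := by
  have : L / invErlangB s L < L := div_lt_self hL (one_lt_invErlangB hs hL)
  rw [meanIdle]
  linarith

theorem sub_lt_meanIdle (s : ℕ) (hL : 0 < L) : s - L < meanIdle s L := by
  rw [meanIdle, lt_add_iff_pos_right]
  exact div_pos hL (invErlangB_pos s hL)

theorem hasDerivAt_invErlangB (s : ℕ) (hL : 0 < L) :
    HasDerivAt (invErlangB s) (-(invErlangB s L * meanIdle s L / L)) L := by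
  induction s with
  | zero =>
    rw [meanIdle_zero, mul_zero, zero_div, neg_zero]
    exact hasDerivAt_const L (1 : ℝ)
  | succ s ih =>
    refine ((((hasDerivAt_const L ((s : ℝ) + 1)).div (hasDerivAt_id L) hL.ne').mul
      ih).const_add 1).congr_deriv ?_
    have := invErlangB_pos s hL
    have := invErlangB_pos (s + 1) hL
    rw [meanIdle_succ_eq_div s hL]
    simp only [id, Pi.div_apply]
    field_simp
    ring

theorem hasDerivAt_meanIdle (s : ℕ) (hL : 0 < L) :
    HasDerivAt (meanIdle s) (-1 + (1 + meanIdle s L) / invErlangB s L) L := by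
  have hR := invErlangB_pos s hL
  refine (((hasDerivAt_id L).const_sub (s : ℝ)).add
    ((hasDerivAt_id L).div (hasDerivAt_invErlangB s hL) hR.ne')).congr_deriv ?_
  simp only [id]
  field_simp
  ring

theorem tendsto_meanIdle_atTop (s : ℕ) : Tendsto (meanIdle s) atTop (𝓝 0) := by
  induction s with
  | zero => exact tendsto_const_nhds.congr fun L ↦ (meanIdle_zero L).symm
  | succ s ih =>
    have hden : Tendsto (fun L ↦ L + 1 + meanIdle s L) atTop atTop :=
      (tendsto_atTop_add_const_right _ 1 tendsto_id).atTop_add ih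
    refine (((ih.const_add 1).const_mul ((s : ℝ) + 1)).div_atTop hden).congr' ?_
    filter_upwards [eventually_gt_atTop 0] with L hL using (meanIdle_succ s hL).symm

/-- The ratio of `N` to `1/B - 1`, where `N` is the mean number of idle servers. The load
maximizing the carried traffic is the one at which this ratio is `1/2`. -/
noncomputable def idleRatio (s : ℕ) (L : ℝ) : ℝ := meanIdle s L / (invErlangB s L - 1)

theorem idleRatio_succ (s : ℕ) (hL : 0 < L) :
    idleRatio (s + 1) L = 1 - (meanIdle (s + 1) L - meanIdle s L) := by
  have := invErlangB_pos s hL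
  have : 0 < L + (s + 1) * invErlangB s L := by positivity
  rw [idleRatio, meanIdle, meanIdle, invErlangB_succ]
  push_cast
  field_simp
  ring

theorem idleRatio_lt_one (hs : 1 ≤ s) (hL : 0 < L) : idleRatio s L < 1 := by
  obtain ⟨k, rfl⟩ := Nat.exists_eq_add_of_le' hs
  rw [idleRatio_succ k hL, sub_lt_self_iff, sub_pos]
  exact meanIdle_lt_succ k hL

theorem meanIdle_lt_invErlangB_sub_one (hs : 1 ≤ s) (hL : 0 < L) :
    meanIdle s L < invErlangB s L - 1 :=
  (div_lt_one (sub_pos.2 (one_lt_invErlangB hs hL))).1 (idleRatio_lt_one hs hL)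

theorem idleRatio_lt (hs : 1 ≤ s) (hL : 0 < L) : idleRatio s L < L := by
  obtain ⟨k, rfl⟩ := Nat.exists_eq_add_of_le' hs
  rw [idleRatio, div_lt_iff₀ (sub_pos.2 (one_lt_invErlangB hs hL))]
  calc meanIdle (k + 1) L < (k + 1 : ℕ) := meanIdle_lt hs hL
    _ ≤ (k + 1) * invErlangB k L := by
      push_cast
      exact le_mul_of_one_le_right (by positivity) (one_le_invErlangB k hL)
    _ = L * (invErlangB (k + 1) L - 1) := by
      rw [invErlangB_succ]
      field_simp
      ring

theorem tendsto_idleRatio_atTop (hs : 1 ≤ s) : Tendsto (idleRatio s) atTop (𝓝 1) := by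
  obtain ⟨k, rfl⟩ := Nat.exists_eq_add_of_le' hs
  have hlim := ((tendsto_meanIdle_atTop (k + 1)).sub (tendsto_meanIdle_atTop k)).const_sub 1
  rw [sub_self, sub_zero] at hlim
  refine hlim.congr' ?_
  filter_upwards [eventually_gt_atTop 0] with L hL using (idleRatio_succ k hL).symm

theorem meanIdle_strictAntiOn (hs : 1 ≤ s) : StrictAntiOn (meanIdle s) (Ioi 0) := by
  refine strictAntiOn_of_hasDerivWithinAt_neg (convex_Ioi 0)
    (HasDerivAt.continuousOn fun L hL ↦ hasDerivAt_meanIdle s hL)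
    (fun L hL ↦ (hasDerivAt_meanIdle s (interior_subset hL)).hasDerivWithinAt) fun L hL ↦ ?_
  have hL : 0 < L := interior_subset hL
  have hlt : (1 + meanIdle s L) / invErlangB s L < 1 := by
    rw [div_lt_one (invErlangB_pos s hL)]
    linarith [meanIdle_lt_invErlangB_sub_one hs hL]
  linarith

theorem exists_meanIdle_eq {c : ℝ} (hc0 : 0 < c) (hcs : c < s) :
    ∃ L, 0 < L ∧ meanIdle s L = c := by
  have hcont : ContinuousOn (meanIdle s) (Ioi 0) :=
    HasDerivAt.continuousOn fun L hL ↦ hasDerivAt_meanIdle s hL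
  obtain ⟨b, hb, hNb⟩ := ((eventually_gt_atTop 0).and
    ((tendsto_meanIdle_atTop s).eventually_lt_const hc0)).exists
  have hNa : c < meanIdle s (s - c) := by simpa using sub_lt_meanIdle s (sub_pos.2 hcs)
  obtain ⟨L, hL, hNL⟩ := isPreconnected_Ioi.intermediate_value hb (sub_pos.2 hcs) hcont
    ⟨hNb.le, hNa.le⟩
  exact ⟨L, hL, hNL⟩

theorem hasDerivAt_idleRatio (hs : 1 ≤ s) (hL : 0 < L) :
    HasDerivAt (idleRatio s)
      (idleRatio s L ^ 2 * invErlangB s L / L - (1 - idleRatio s L) / invErlangB s L) L := by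
  have hR1 : invErlangB s L - 1 ≠ 0 := (sub_pos.2 (one_lt_invErlangB hs hL)).ne'
  have hR := invErlangB_pos s hL
  refine ((hasDerivAt_meanIdle s hL).div ((hasDerivAt_invErlangB s hL).sub_const 1)
    hR1).congr_deriv ?_
  rw [idleRatio]
  field_simp
  ring

/-- The derivative of `idleRatio s` up to a positive factor chosen so that the product is
decreasing in `L`, see `deriv_idleRatio_eq`. -/
noncomputable def idleWronskian (s : ℕ) (L : ℝ) : ℝ :=
  L ^ s * Real.exp (-L) / invErlangB s L *
    (meanIdle s L ^ 2 * invErlangB s L ^ 2 -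
      L * (invErlangB s L - 1) * (invErlangB s L - 1 - meanIdle s L))

theorem hasDerivAt_idleWronskian (s : ℕ) (hL : 0 < L) :
    HasDerivAt (idleWronskian s)
      (-(L ^ s * Real.exp (-L) / invErlangB s L * ((invErlangB s L - 1) *
        (invErlangB s L - 1 - meanIdle s L) * (2 * meanIdle s L + 1)))) L := by
  have hR0 := invErlangB_pos s hL
  have hR := hasDerivAt_invErlangB s hL
  have hN := hasDerivAt_meanIdle s hL
  have hpow : HasDerivAt (fun x : ℝ ↦ x ^ s) (s / L * L ^ s) L := by
    refine (hasDerivAt_pow s L).congr_deriv ?_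
    rcases s with _ | k
    · simp
    · rw [Nat.add_sub_cancel]
      field_simp
      ring
  have hexp : HasDerivAt (fun x : ℝ ↦ Real.exp (-x)) (Real.exp (-L) * -1) L :=
    (hasDerivAt_neg L).exp
  refine (((hpow.mul hexp).div hR hR0.ne').mul (((hN.pow 2).mul (hR.pow 2)).sub
    (((hasDerivAt_id L).mul (hR.sub_const 1)).mul ((hR.sub_const 1).sub hN)))).congr_deriv ?_
  simp only [Pi.mul_apply, Pi.pow_apply, Pi.div_apply, Pi.sub_apply, id]
  have hs : (s : ℝ) = meanIdle s L + L - L / invErlangB s L := by rw [meanIdle]; ring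
  rw [hs]
  field_simp
  ring

theorem tendsto_idleWronskian_atTop (s : ℕ) : Tendsto (idleWronskian s) atTop (𝓝 0) := by
  have hR := tendsto_invErlangB_atTop s
  have hN := tendsto_meanIdle_atTop s
  have hpow := Real.tendsto_pow_mul_exp_neg_atTop_nhds_zero
  have hlim := ((hpow s).mul ((hN.pow 2).mul hR)).sub
    (((hpow (s + 1)).mul ((hR.sub_const 1).mul ((hR.sub_const 1).sub hN))).div hR one_ne_zero)
  norm_num at hlim
  refine hlim.congr' ?_
  filter_upwards [eventually_gt_atTop 0] with L hL
  have := invErlangB_pos s hL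
  rw [idleWronskian]
  field_simp
  ring

theorem idleWronskian_strictAntiOn (hs : 1 ≤ s) : StrictAntiOn (idleWronskian s) (Ioi 0) := by
  refine strictAntiOn_of_hasDerivWithinAt_neg (convex_Ioi 0)
    (HasDerivAt.continuousOn fun L hL ↦ hasDerivAt_idleWronskian s hL)
    (fun L hL ↦ (hasDerivAt_idleWronskian s (interior_subset hL)).hasDerivWithinAt) fun L hL ↦ ?_
  have hL : 0 < L := interior_subset hL
  have hR := invErlangB_pos s hL
  have hR1 : 0 < invErlangB s L - 1 := sub_pos.2 (one_lt_invErlangB hs hL)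
  have hN := meanIdle_nonneg s hL
  have hRN : 0 < invErlangB s L - 1 - meanIdle s L :=
    sub_pos.2 (meanIdle_lt_invErlangB_sub_one hs hL)
  rw [neg_lt_zero]
  positivity

theorem lt_of_strictAntiOn_Ioi_of_tendsto_atTop {α β : Type*} [LinearOrder α] [NoMaxOrder α]
    [Preorder β] [TopologicalSpace β] [ClosedIicTopology β] {f : α → β} {a x : α} {l : β}
    (hf : StrictAntiOn f (Ioi a)) (hl : Tendsto f atTop (𝓝 l)) (hx : a < x) : l < f x := by
  obtain ⟨y, hxy⟩ := exists_gt x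
  have : Nonempty α := ⟨x⟩
  have hly : l ≤ f y := by
    refine le_of_tendsto hl ?_
    filter_upwards [eventually_ge_atTop y] with z hyz
    exact hf.antitoneOn (hx.trans hxy) ((hx.trans hxy).trans_le hyz) hyz
  exact hly.trans_lt (hf hx (hx.trans hxy) hxy)

theorem idleWronskian_pos (hs : 1 ≤ s) (hL : 0 < L) : 0 < idleWronskian s L :=
  lt_of_strictAntiOn_Ioi_of_tendsto_atTop (idleWronskian_strictAntiOn hs)
    (tendsto_idleWronskian_atTop s) hL

theorem deriv_idleRatio_eq (hs : 1 ≤ s) (hL : 0 < L) :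
    deriv (idleRatio s) L =
      idleWronskian s L / (L ^ (s + 1) * Real.exp (-L) * (invErlangB s L - 1) ^ 2) := by
  have hR1 : 0 < invErlangB s L - 1 := sub_pos.2 (one_lt_invErlangB hs hL)
  have hR := invErlangB_pos s hL
  rw [(hasDerivAt_idleRatio hs hL).deriv, idleRatio, idleWronskian]
  field_simp
  ring

theorem idleRatio_strictMonoOn (hs : 1 ≤ s) : StrictMonoOn (idleRatio s) (Ioi 0) := by
  refine strictMonoOn_of_deriv_pos (convex_Ioi 0)
    (HasDerivAt.continuousOn fun L hL ↦ hasDerivAt_idleRatio hs hL) fun L hL ↦ ?_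
  have hL : 0 < L := interior_subset hL
  have hR1 : 0 < invErlangB s L - 1 := sub_pos.2 (one_lt_invErlangB hs hL)
  have := idleWronskian_pos hs hL
  rw [deriv_idleRatio_eq hs hL]
  positivity

theorem exists_idleRatio_eq_half (hs : 1 ≤ s) : ∃ L, 0 < L ∧ idleRatio s L = 1 / 2 := by
  have hcont : ContinuousOn (idleRatio s) (Ioi 0) :=
    HasDerivAt.continuousOn fun L hL ↦ hasDerivAt_idleRatio hs hL
  obtain ⟨b, hb, hQb⟩ := ((eventually_gt_atTop 0).and
    ((tendsto_idleRatio_atTop hs).eventually_const_lt one_half_lt_one)).exists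
  have ha : (0 : ℝ) < 1 / 2 := by norm_num
  obtain ⟨L, hL, hQL⟩ := isPreconnected_Ioi.intermediate_value ha hb hcont
    ⟨(idleRatio_lt hs ha).le, hQb.le⟩
  exact ⟨L, hL, hQL⟩

end Erlang

/-! ### The maximizer -/

section Cohen

variable {s : ℕ} {γ L : ℝ}

theorem sqrt_natCast_pos (hs : 1 ≤ s) : 0 < √(s : ℝ) :=
  Real.sqrt_pos.2 (Nat.cast_pos.2 hs)

theorem fErlang_eq (hs : 1 ≤ s) (δ : ℝ) :
    fErlang s δ = (s - δ * √(s : ℝ)) / √(s : ℝ) * erlangB s (s - δ * √(s : ℝ)) := by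
  have := sqrt_natCast_pos hs
  rw [fErlang]
  congr 1
  nth_rewrite 3 [← Real.mul_self_sqrt s.cast_nonneg]
  field_simp

theorem isCohenSol_iff_meanIdle_eq (hs : 1 ≤ s) (hγ : γ < √(s : ℝ)) (a : ℝ) :
    IsCohenSol s γ a ↔ 0 < s - (γ - a) * √(s : ℝ) ∧
      meanIdle s (s - (γ - a) * √(s : ℝ)) = γ * √(s : ℝ) := by
  have hσ := sqrt_natCast_pos hs
  have hσ2 := Real.mul_self_sqrt (s.cast_nonneg (α := ℝ))
  have hdom : γ - a ≤ √(s : ℝ) ↔ 0 ≤ s - (γ - a) * √(s : ℝ) := by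
    rw [sub_nonneg, ← mul_le_mul_iff_of_pos_right hσ, hσ2]
  obtain ⟨Λ, hΛ⟩ : ∃ Λ, s - (γ - a) * √(s : ℝ) = Λ := ⟨_, rfl⟩
  have ha : a = (Λ - s + γ * √(s : ℝ)) / √(s : ℝ) := by
    rw [eq_div_iff hσ.ne', ← hΛ]
    ring
  rw [IsCohenSol, fErlang_eq hs, hdom, hΛ]
  rcases lt_trichotomy Λ 0 with hneg | rfl | hpos
  · simp only [hneg.not_ge, hneg.not_gt, false_and]
  · have hne : γ * √(s : ℝ) ≠ s := ((mul_lt_mul_of_pos_right hγ hσ).trans_eq hσ2).ne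
    have ha0 : a ≠ 0 := by
      rw [ha, div_ne_zero_iff]
      exact ⟨fun h ↦ hne (by linarith), hσ.ne'⟩
    simp [ha0]
  · rw [erlangB_eq_inv_invErlangB s hpos, ha, meanIdle, ← div_eq_mul_inv, div_right_comm,
      div_left_inj' hσ.ne']
    simp only [hpos.le, hpos, true_and]
    constructor <;> intro h <;> linarith

theorem existsUnique_isCohenSol (hs : 1 ≤ s) (hγ : γ ∈ Ioo 0 √(s : ℝ)) :
    ∃! a : ℝ, IsCohenSol s γ a := by
  have hσ := sqrt_natCast_pos hs
  have hγs : γ * √(s : ℝ) < s := by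
    simpa using mul_lt_mul_of_pos_right hγ.2 hσ
  obtain ⟨L, hL, hN⟩ := exists_meanIdle_eq (mul_pos hγ.1 hσ) hγs
  have hrate : (s : ℝ) - (γ - (γ + (L - s) / √(s : ℝ))) * √(s : ℝ) = L := by
    field_simp
    ring
  refine ⟨γ + (L - s) / √(s : ℝ), ?_, fun a ha ↦ ?_⟩
  · exact (isCohenSol_iff_meanIdle_eq hs hγ.2 _).2 (hrate.symm ▸ ⟨hL, hN⟩)
  · obtain ⟨hpos, hNa⟩ := (isCohenSol_iff_meanIdle_eq hs hγ.2 a).1 ha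
    have := (meanIdle_strictAntiOn hs).injOn hpos hL (hNa.trans hN.symm)
    rw [← this]
    field_simp
    ring

/-- The total arrival rate `s - (γ - a_s(γ)) √s` at the solution of the Cohen equation. -/
noncomputable def cohenRate (s : ℕ) (γ : ℝ) : ℝ := s - (γ - cohenA s γ) * √(s : ℝ)

theorem cohenRate_pos (hs : 1 ≤ s) (hγ : γ ∈ Ioo 0 √(s : ℝ)) : 0 < cohenRate s γ :=
  ((isCohenSol_iff_meanIdle_eq hs hγ.2 _).1
    (Classical.epsilon_spec (existsUnique_isCohenSol hs hγ).exists)).1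

theorem meanIdle_cohenRate (hs : 1 ≤ s) (hγ : γ ∈ Ioo 0 √(s : ℝ)) :
    meanIdle s (cohenRate s γ) = γ * √(s : ℝ) :=
  ((isCohenSol_iff_meanIdle_eq hs hγ.2 _).1
    (Classical.epsilon_spec (existsUnique_isCohenSol hs hγ).exists)).2

theorem meanIdle_div_sqrt_mem_Ioo (hs : 1 ≤ s) (hL : 0 < L) :
    meanIdle s L / √(s : ℝ) ∈ Ioo 0 √(s : ℝ) := by
  have hσ := sqrt_natCast_pos hs
  refine ⟨div_pos (meanIdle_pos hs hL) hσ, ?_⟩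
  rw [div_lt_iff₀ hσ, Real.mul_self_sqrt s.cast_nonneg]
  exact meanIdle_lt hs hL

theorem cohenRate_meanIdle_div_sqrt (hs : 1 ≤ s) (hL : 0 < L) :
    cohenRate s (meanIdle s L / √(s : ℝ)) = L := by
  have hmem := meanIdle_div_sqrt_mem_Ioo hs hL
  refine (meanIdle_strictAntiOn hs).injOn (cohenRate_pos hs hmem) hL ?_
  rw [meanIdle_cohenRate hs hmem, div_mul_cancel₀ _ (sqrt_natCast_pos hs).ne']

/-- The carried traffic `L (1 - B(s, L))²` as a function of the total arrival rate. -/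
noncomputable def rateCarried (s : ℕ) (L : ℝ) : ℝ := L * (1 - (invErlangB s L)⁻¹) ^ 2

theorem carriedL_eq_rateCarried_div_sqrt (hs : 1 ≤ s) (hγ : γ ∈ Ioo 0 √(s : ℝ)) :
    carriedL s γ = rateCarried s (cohenRate s γ) / √(s : ℝ) := by
  have hσ := sqrt_natCast_pos hs
  have hσ2 := Real.mul_self_sqrt (s.cast_nonneg (α := ℝ))
  have hL := cohenRate_pos hs hγ
  have hcarried : √(s : ℝ) - γ =
      cohenRate s γ * (1 - (invErlangB s (cohenRate s γ))⁻¹) / √(s : ℝ) := by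
    rw [eq_div_iff hσ.ne', sub_mul, hσ2, ← meanIdle_cohenRate hs hγ, meanIdle]
    ring
  have hoffered : √(s : ℝ) - γ + cohenA s γ = cohenRate s γ / √(s : ℝ) := by
    rw [eq_div_iff hσ.ne', cohenRate, add_mul, sub_mul, hσ2]
    ring
  rw [carriedL, hoffered, hcarried, rateCarried]
  field_simp

theorem hasDerivAt_rateCarried (hs : 1 ≤ s) (hL : 0 < L) :
    HasDerivAt (rateCarried s)
      ((1 - (invErlangB s L)⁻¹) ^ 2 * (1 - 2 * idleRatio s L)) L := by
  have hR := invErlangB_pos s hL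
  have hR1 : invErlangB s L - 1 ≠ 0 := (sub_pos.2 (one_lt_invErlangB hs hL)).ne'
  refine ((hasDerivAt_id L).mul
    ((((hasDerivAt_invErlangB s hL).inv hR.ne').const_sub 1).pow 2)).congr_deriv ?_
  simp only [id, Pi.pow_apply, Pi.inv_apply, Nat.reduceSub, pow_one, Nat.cast_ofNat]
  rw [idleRatio]
  field_simp
  ring

theorem one_sub_inv_invErlangB_sq_pos (hs : 1 ≤ s) (hL : 0 < L) :
    0 < (1 - (invErlangB s L)⁻¹) ^ 2 :=
  pow_pos (sub_pos.2 (inv_lt_one_of_one_lt₀ (one_lt_invErlangB hs hL))) 2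

theorem rateCarried_strictMonoOn (hs : 1 ≤ s) (hL : 0 < L) (hQ : idleRatio s L = 1 / 2) :
    StrictMonoOn (rateCarried s) (Ioc 0 L) := by
  refine strictMonoOn_of_deriv_pos (convex_Ioc 0 L)
    (HasDerivAt.continuousOn fun x hx ↦ hasDerivAt_rateCarried hs hx.1) fun x hx ↦ ?_
  rw [interior_Ioc] at hx
  rw [(hasDerivAt_rateCarried hs hx.1).deriv]
  have := idleRatio_strictMonoOn hs hx.1 hL hx.2
  exact mul_pos (one_sub_inv_invErlangB_sq_pos hs hx.1) (by linarith)

theorem rateCarried_strictAntiOn (hs : 1 ≤ s) (hL : 0 < L) (hQ : idleRatio s L = 1 / 2) :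
    StrictAntiOn (rateCarried s) (Ici L) := by
  refine strictAntiOn_of_deriv_neg (convex_Ici L)
    (HasDerivAt.continuousOn fun x hx ↦ hasDerivAt_rateCarried hs (hL.trans_le hx))
    fun x hx ↦ ?_
  rw [interior_Ici] at hx
  have hx0 : 0 < x := hL.trans hx
  rw [(hasDerivAt_rateCarried hs hx0).deriv]
  have := idleRatio_strictMonoOn hs hL hx0 hx
  exact mul_neg_of_pos_of_neg (one_sub_inv_invErlangB_sq_pos hs hx0) (by linarith)

theorem rateCarried_lt_of_ne {L₀ : ℝ} (hs : 1 ≤ s) (hL₀ : 0 < L₀) (hQ : idleRatio s L₀ = 1 / 2)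
    (hL : 0 < L) (hne : L ≠ L₀) : rateCarried s L < rateCarried s L₀ := by
  rcases hne.lt_or_gt with hlt | hgt
  · exact rateCarried_strictMonoOn hs hL₀ hQ ⟨hL, hlt.le⟩ ⟨hL₀, le_rfl⟩ hlt
  · exact rateCarried_strictAntiOn hs hL₀ hQ self_mem_Ici hgt.le hgt

theorem carriedL_lt_of_ne (hs : 1 ≤ s) (hL : 0 < L) (hQ : idleRatio s L = 1 / 2)
    (hγ : γ ∈ Ioo 0 √(s : ℝ)) (hne : γ ≠ meanIdle s L / √(s : ℝ)) :
    carriedL s γ < carriedL s (meanIdle s L / √(s : ℝ)) := by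
  have hσ := sqrt_natCast_pos hs
  rw [carriedL_eq_rateCarried_div_sqrt hs hγ,
    carriedL_eq_rateCarried_div_sqrt hs (meanIdle_div_sqrt_mem_Ioo hs hL),
    cohenRate_meanIdle_div_sqrt hs hL, div_lt_div_iff_of_pos_right hσ]
  refine rateCarried_lt_of_ne hs hL hQ (cohenRate_pos hs hγ) fun heq ↦ hne ?_
  rw [← heq, meanIdle_cohenRate hs hγ, mul_div_cancel_right₀ _ hσ.ne']

theorem isMaximizerL_iff_eq (hs : 1 ≤ s) (hL : 0 < L) (hQ : idleRatio s L = 1 / 2) :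
    IsMaximizerL s γ ↔ γ = meanIdle s L / √(s : ℝ) := by
  have hmem := meanIdle_div_sqrt_mem_Ioo hs hL
  constructor
  · rintro ⟨hγ, hmax⟩
    by_contra hne
    exact (carriedL_lt_of_ne hs hL hQ hγ hne).not_ge (hmax hmem)
  · rintro rfl
    refine ⟨hmem, isMaxOn_iff.2 fun γ hγ ↦ ?_⟩
    rcases eq_or_ne γ (meanIdle s L / √(s : ℝ)) with rfl | hne
    · exact le_rfl
    · exact (carriedL_lt_of_ne hs hL hQ hγ hne).le

theorem existsUnique_isMaximizerL (hs : 1 ≤ s) : ∃! γ : ℝ, IsMaximizerL s γ := by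
  obtain ⟨L, hL, hQ⟩ := exists_idleRatio_eq_half hs
  exact ⟨_, (isMaximizerL_iff_eq hs hL hQ).2 rfl, fun γ hγ ↦ (isMaximizerL_iff_eq hs hL hQ).1 hγ⟩

theorem isMaximizerL_gammaHat (hs : 1 ≤ s) : IsMaximizerL s (gammaHat s) :=
  Classical.epsilon_spec (existsUnique_isMaximizerL hs).exists

theorem gammaHat_mem_Ioo (hs : 1 ≤ s) : gammaHat s ∈ Ioo 0 √(s : ℝ) :=
  (isMaximizerL_gammaHat hs).1

/-- The total arrival rate `(s - c) (1 + 2 c) / (2 c)` for which `c` idle servers amount to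
`1 / B = 1 + 2 c`, the latter being the condition for an optimum. -/
noncomputable def criticalRate (s c : ℝ) : ℝ := (s - c) * (1 + 2 * c) / (2 * c)

theorem criticalRate_pos {s c : ℝ} (hc : 0 < c) (hcs : c < s) : 0 < criticalRate s c := by
  have := sub_pos.2 hcs
  rw [criticalRate]
  positivity

theorem cmp_eq_cmp_of_sub_eq_mul {R : Type*} [Ring R] [LinearOrder R] [IsStrictOrderedRing R]
    {a b c d k : R} (hk : 0 < k) (h : a - b = k * (c - d)) : cmp a b = cmp c d := by
  rw [← cmp_sub_zero a b, h, ← mul_zero k, cmp_mul_pos_left hk, cmp_sub_zero]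

theorem cmp_meanIdle_criticalRate {c : ℝ} (hc : 0 < c) (hcs : c < s) :
    cmp c (meanIdle s (criticalRate s c)) =
      cmp (invErlangB s (criticalRate s c)) (1 + 2 * c) := by
  have hC := criticalRate_pos hc hcs
  have hR := invErlangB_pos s hC
  refine cmp_eq_cmp_of_sub_eq_mul
    (k := criticalRate s c / (invErlangB s (criticalRate s c) * (1 + 2 * c))) (by positivity) ?_
  have hsc : (s : ℝ) - c = criticalRate s c * (2 * c) / (1 + 2 * c) := by
    rw [criticalRate]
    field_simp
  have hsub : c - meanIdle s (criticalRate s c) = criticalRate s c - (s - c) -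
      criticalRate s c / invErlangB s (criticalRate s c) := by
    rw [meanIdle]
    ring
  rw [hsub, hsc]
  field_simp
  ring

theorem cmp_criticalRate (hs : 1 ≤ s) (hL : 0 < L) :
    cmp (criticalRate s (meanIdle s L)) L = cmp (invErlangB s L) (1 + 2 * meanIdle s L) := by
  have hN := meanIdle_pos hs hL
  have hR := invErlangB_pos s hL
  have hR1 : 0 < invErlangB s L - 1 := sub_pos.2 (one_lt_invErlangB hs hL)
  have hNs : 0 < s - meanIdle s L := sub_pos.2 (meanIdle_lt hs hL)
  refine cmp_eq_cmp_of_sub_eq_mul (k := (s - meanIdle s L) /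
    (2 * meanIdle s L * (invErlangB s L - 1))) (by positivity) ?_
  have hLN : L = (s - meanIdle s L) * invErlangB s L / (invErlangB s L - 1) := by
    rw [meanIdle]
    field_simp
    ring
  nth_rewrite 2 [hLN]
  rw [criticalRate]
  field_simp
  ring

theorem cmp_half_idleRatio (hs : 1 ≤ s) (hL : 0 < L) :
    cmp (1 / 2) (idleRatio s L) = cmp (invErlangB s L) (1 + 2 * meanIdle s L) := by
  have hR1 : 0 < invErlangB s L - 1 := sub_pos.2 (one_lt_invErlangB hs hL)
  refine cmp_eq_cmp_of_sub_eq_mul (k := 1 / (2 * (invErlangB s L - 1))) (by positivity) ?_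
  rw [idleRatio]
  field_simp
  ring

theorem cmp_half_idleRatio_cohenRate (hs : 1 ≤ s) (hγ : γ ∈ Ioo 0 √(s : ℝ)) :
    cmp (1 / 2) (idleRatio s (cohenRate s γ)) = cmp γ (gammaHat s) := by
  have hσ := sqrt_natCast_pos hs
  have hL := cohenRate_pos hs hγ
  obtain ⟨L₀, hL₀, hQ₀⟩ := exists_idleRatio_eq_half hs
  have hγ₀ := (isMaximizerL_iff_eq hs hL₀ hQ₀).1 (isMaximizerL_gammaHat hs)
  rw [← hQ₀, (idleRatio_strictMonoOn hs).cmp_map_eq hL₀ hL,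
    ← (meanIdle_strictAntiOn hs).cmp_map_eq hL hL₀, meanIdle_cohenRate hs hγ, hγ₀,
    ← cmp_mul_pos_right hσ γ, div_mul_cancel₀ _ hσ.ne']

theorem cmp_invErlangB_criticalRate (hs : 1 ≤ s) (hγ : γ ∈ Ioo 0 √(s : ℝ)) :
    cmp (invErlangB s (criticalRate s (γ * √(s : ℝ)))) (1 + 2 * (γ * √(s : ℝ))) =
      cmp γ (gammaHat s) := by
  have hL := cohenRate_pos hs hγ
  have hc0 := meanIdle_pos hs hL
  have hcs := meanIdle_lt hs hL
  have hC := criticalRate_pos hc0 hcs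
  rw [← cmp_half_idleRatio_cohenRate hs hγ, cmp_half_idleRatio hs hL, ← cmp_criticalRate hs hL,
    ← (meanIdle_strictAntiOn hs).cmp_map_eq hL hC, ← meanIdle_cohenRate hs hγ,
    cmp_meanIdle_criticalRate hc0 hcs]

theorem invErlangB_criticalRate_gammaHat (hs : 1 ≤ s) :
    invErlangB s (criticalRate s (gammaHat s * √(s : ℝ))) = 1 + 2 * (gammaHat s * √(s : ℝ)) := by
  rw [← cmp_eq_eq_iff, cmp_invErlangB_criticalRate hs (gammaHat_mem_Ioo hs), cmp_self_eq_eq]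

theorem lt_gammaHat_iff (hs : 1 ≤ s) (hγ : γ ∈ Ioo 0 √(s : ℝ)) :
    γ < gammaHat s ↔
      invErlangB s (criticalRate s (γ * √(s : ℝ))) < 1 + 2 * (γ * √(s : ℝ)) :=
  (lt_iff_lt_of_cmp_eq_cmp (cmp_invErlangB_criticalRate hs hγ)).symm

theorem gammaHat_lt_iff (hs : 1 ≤ s) (hγ : γ ∈ Ioo 0 √(s : ℝ)) :
    gammaHat s < γ ↔
      1 + 2 * (γ * √(s : ℝ)) < invErlangB s (criticalRate s (γ * √(s : ℝ))) :=
  (lt_iff_lt_of_cmp_eq_cmp (cmp_eq_cmp_symm.1 (cmp_invErlangB_criticalRate hs hγ))).symm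

theorem gammaHat_one : gammaHat 1 = 1 / 2 := by
  obtain ⟨h0, h1⟩ := gammaHat_mem_Ioo le_rfl
  have hopt := invErlangB_criticalRate_gammaHat le_rfl
  simp only [Nat.cast_one, Real.sqrt_one, mul_one, invErlangB, criticalRate] at hopt h1
  have := sub_pos.2 h1
  field_simp at hopt
  norm_num at hopt
  have hmul : gammaHat 1 ^ 2 * (1 / 2 - gammaHat 1) = 0 := by linarith
  linarith [(mul_eq_zero.1 hmul).resolve_left (pow_pos h0 2).ne']

theorem three_fifths_lt_gammaHat_two : 3 / 5 < gammaHat 2 := by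
  have hlo : (1.4142 : ℝ) < √2 := Real.lt_sqrt_of_sq_lt (by norm_num)
  have hmem : (3 / 5 : ℝ) ∈ Ioo 0 √((2 : ℕ) : ℝ) := by
    push_cast
    constructor <;> linarith
  rw [lt_gammaHat_iff one_le_two hmem]
  simp only [invErlangB]
  push_cast
  have hC : 1.829 < criticalRate 2 (3 / 5 * √2) := by
    have hhi : √2 < (1.4143 : ℝ) := (Real.sqrt_lt' (by norm_num)).2 (by norm_num)
    rw [criticalRate, lt_div_iff₀ (by positivity)]
    linarith [Real.mul_self_sqrt zero_le_two]
  generalize criticalRate 2 (3 / 5 * √2) = L at hC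
  have hinv : L⁻¹ < 1.829⁻¹ := inv_strictAnti₀ (by norm_num) hC
  have hinv0 : 0 < L⁻¹ := inv_pos.2 (by linarith)
  calc 1 + (1 + 1) / L * (1 + (0 + 1) / L * 1) = 1 + 2 * L⁻¹ + 2 * L⁻¹ ^ 2 := by ring
    _ < 1 + 2 * 1.829⁻¹ + 2 * 1.829⁻¹ ^ 2 := by gcongr
    _ < 1 + 2 * (3 / 5 * √2) := by linarith

end Cohen

/-! ### Monotonicity in the number of servers -/

section Monotonicity

/-- The coefficients of the expansion of `R(s, L - h) - 1` in powers of `h`, where `R = 1 / B`,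
in terms of the value `r` of `R(s, L)`. The recursion encodes the linear differential equation
`L R' = (L - s) R - L`; keeping `r` free lets a lower bound for `R(s, L)` be substituted. -/
noncomputable def erlangCoeff (s L r : ℝ) : ℕ → ℝ
  | 0 => r - 1
  | 1 => ((s - L) * (r - 1) + s) / L
  | j + 2 => ((s - L + j + 1) * erlangCoeff s L r (j + 1) + erlangCoeff s L r j) / ((j + 2) * L)

theorem erlangCoeff_add_two (s L r : ℝ) (j : ℕ) :
    erlangCoeff s L r (j + 2) =
      ((s - L + j + 1) * erlangCoeff s L r (j + 1) + erlangCoeff s L r j) / ((j + 2) * L) := rfl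

section Succ

variable {s L r r' : ℝ}

theorem mul_erlangCoeff_succ_zero (hL : L ≠ 0) (hr : r' = 1 + (s + 1) / L * r) :
    L * erlangCoeff (s + 1) L r' 0 = (s + 1) * (1 + erlangCoeff s L r 0) := by
  simp only [erlangCoeff, hr]
  field_simp
  ring

theorem mul_erlangCoeff_succ_succ (hL : L ≠ 0) (hr : r' = 1 + (s + 1) / L * r) (j : ℕ) :
    L * erlangCoeff (s + 1) L r' (j + 1) =
      (s + 1) * erlangCoeff s L r (j + 1) + erlangCoeff (s + 1) L r' j := by
  induction j using Nat.twoStepInduction with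
  | zero =>
    simp only [erlangCoeff, hr]
    field_simp
    ring
  | one =>
    simp only [erlangCoeff, hr]
    field_simp
    ring
  | more j ih ih' =>
    have hode : (j + 2) * L * erlangCoeff (s + 1) L r' (j + 2) =
        (s + 1 - L + j + 1) * erlangCoeff (s + 1) L r' (j + 1) + erlangCoeff (s + 1) L r' j := by
      rw [erlangCoeff_add_two]
      field_simp
    rw [erlangCoeff_add_two, erlangCoeff_add_two s]
    push_cast
    field_simp
    linear_combination ih + (s - L + j + 2) * ih' - hode

theorem sub_mul_sum_erlangCoeff_succ (hL : L ≠ 0) (hr : r' = 1 + (s + 1) / L * r) (h : ℝ) (n : ℕ) :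
    (L - h) * ∑ j ∈ Finset.range (n + 1), erlangCoeff (s + 1) L r' j * h ^ j =
      (s + 1) * (1 + ∑ j ∈ Finset.range (n + 1), erlangCoeff s L r j * h ^ j) -
        erlangCoeff (s + 1) L r' n * h ^ (n + 1) := by
  induction n with
  | zero =>
    simp only [zero_add, Finset.sum_range_one, pow_zero, mul_one]
    linear_combination mul_erlangCoeff_succ_zero hL hr
  | succ n ih =>
    rw [Finset.sum_range_succ, mul_add, ih, Finset.sum_range_succ _ (n + 1)]
    linear_combination h ^ (n + 1) * mul_erlangCoeff_succ_succ hL hr n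

end Succ

theorem erlangCoeff_zero_one (L : ℝ) (j : ℕ) : erlangCoeff 0 L 1 j = 0 := by
  induction j using Nat.twoStepInduction with
  | zero => simp [erlangCoeff]
  | one => simp [erlangCoeff]
  | more j ih ih' => simp [erlangCoeff, ih, ih']

theorem erlangCoeff_invErlangB_nonneg (s : ℕ) {L : ℝ} (hL : 0 < L) (j : ℕ) :
    0 ≤ erlangCoeff s L (invErlangB s L) j := by
  induction s generalizing j with
  | zero => rw [invErlangB, Nat.cast_zero, erlangCoeff_zero_one]
  | succ s ihs =>
    have hr := invErlangB_succ s L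
    rw [Nat.cast_succ]
    induction j with
    | zero =>
      refine nonneg_of_mul_nonneg_right ?_ hL
      rw [mul_erlangCoeff_succ_zero hL.ne' hr]
      have := ihs 0
      positivity
    | succ j ihj =>
      refine nonneg_of_mul_nonneg_right ?_ hL
      rw [mul_erlangCoeff_succ_succ hL.ne' hr]
      have := ihs (j + 1)
      positivity

theorem one_add_sum_erlangCoeff_le_invErlangB (s n : ℕ) {L h : ℝ} (hL : 0 < L) (hh : 0 ≤ h)
    (hhL : h < L) :
    1 + ∑ j ∈ Finset.range (n + 1), erlangCoeff s L (invErlangB s L) j * h ^ j ≤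
      invErlangB s (L - h) := by
  induction s with
  | zero => simp [invErlangB, erlangCoeff_zero_one]
  | succ s ih =>
    have hLh : 0 < L - h := sub_pos.2 hhL
    have htail := mul_nonneg (erlangCoeff_invErlangB_nonneg (s + 1) hL n) (pow_nonneg hh (n + 1))
    rw [Nat.cast_succ] at htail ⊢
    rw [invErlangB_succ s (L - h), add_le_add_iff_left, div_mul_eq_mul_div, le_div_iff₀' hLh,
      sub_mul_sum_erlangCoeff_succ hL.ne' (invErlangB_succ s L)]
    have := mul_le_mul_of_nonneg_left ih (by positivity : (0 : ℝ) ≤ s + 1)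
    linarith

theorem sum_erlangCoeff_mono {s L h r r' : ℝ} (hs : 0 ≤ s) (hL : 0 < L) (hh : 0 ≤ h)
    (hslope : h * (1 - s / L) ≤ 1) (hr : r ≤ r') :
    ∑ j ∈ Finset.range 4, erlangCoeff s L r j * h ^ j ≤
      ∑ j ∈ Finset.range 4, erlangCoeff s L r' j * h ^ j := by
  obtain ⟨y, hy⟩ : ∃ y, h * (1 - s / L) = y := ⟨_, rfl⟩
  have hdiff : ∑ j ∈ Finset.range 4, erlangCoeff s L r' j * h ^ j -
      ∑ j ∈ Finset.range 4, erlangCoeff s L r j * h ^ j =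
      (r' - r) * ((1 - y) + y ^ 2 * (1 - y / 3) / 2 + h ^ 2 / 2 * (s / L ^ 2) * (1 - y) +
        h ^ 3 * s / (3 * L ^ 3)) := by
    simp only [Finset.sum_range_succ, Finset.sum_range_zero, erlangCoeff, ← hy]
    field_simp
    ring
  have h1 : 0 ≤ 1 - y := by linarith
  have h3 : 0 ≤ 1 - y / 3 := by linarith
  have := sub_nonneg.2 hr
  rw [← sub_nonneg, hdiff]
  positivity

/-- With `w = √(s + 1) + √s`, the cubic expansion from the critical rate of `γ` for `s + 1` servers
to that for `s` servers exceeds `1 + 2 γ √s` by a positive multiple of `critPoly γ 1 w`; the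
variable `v` makes the polynomial homogeneous of degree `11` in `(u, v)`. -/
def critPoly (u v w : ℝ) : ℝ :=
  let S := (w ^ 2 - 1) ^ 2
  let H := 2 * u * v * w - 2 * u ^ 2 + v ^ 2
  let m := u * (w ^ 2 + 1) + v * w
  let a := u * (w ^ 2 + 1) - v * w
  let D := (v * (w ^ 2 + 1) - 2 * u * w) * m
  let e := 2 * u * v * w + (v ^ 2 - 2 * u ^ 2) * (w ^ 2 + 1)
  let b := 2 * u * v ^ 2 * S - e * a
  let c := e * b - 8 * u ^ 2 * v ^ 2 * S * m
  24 * u ^ 2 * v ^ 2 * D ^ 2 *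
      (u * v ^ 2 * (3 - w ^ 2) - 2 * u ^ 3 * (w ^ 2 + 1) + 2 * u ^ 2 * v * w - v ^ 3 * w) +
    6 * u * v * H ^ 2 * b * D - H ^ 3 * c

theorem critPoly_mul (u v w k : ℝ) : critPoly (k * u) (k * v) w = k ^ 11 * critPoly u v w := by
  simp only [critPoly]
  ring

set_option maxRecDepth 10000 in
theorem critPoly_one_add_pos {p q : ℝ} (hp : 0 ≤ p) (hq : 0 ≤ q) :
    0 < critPoly (1 + p) 1 (2 * (1 + p) + q) := by
  simp only [critPoly]
  ring_nf
  positivity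

set_option maxRecDepth 10000 in
theorem critPoly_three_fifths_add_pos {t q : ℝ} (ht : 0 ≤ t) (hq : 0 ≤ q) :
    0 < critPoly (3 / 5 + t) (1 + t) (3 + q) := by
  simp only [critPoly]
  ring_nf
  positivity

theorem critPoly_pos {γ w : ℝ} (hγ : 3 / 5 ≤ γ) (hγw : 2 * γ ≤ w) (hw : 3 ≤ w) :
    0 < critPoly γ 1 w := by
  rcases le_or_gt 1 γ with h1 | h1
  · have := critPoly_one_add_pos (sub_nonneg.2 h1) (sub_nonneg.2 hγw)
    rwa [add_sub_cancel, add_sub_cancel] at this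
  · -- `t` solves `(3 / 5 + t) / (1 + t) = γ`
    have hγ1 : 0 < 1 - γ := sub_pos.2 h1
    have ht : 0 ≤ (γ - 3 / 5) / (1 - γ) := div_nonneg (sub_nonneg.2 hγ) hγ1.le
    have hu : 3 / 5 + (γ - 3 / 5) / (1 - γ) = 2 / 5 / (1 - γ) * γ := by
      field_simp
      ring
    have hv : 1 + (γ - 3 / 5) / (1 - γ) = 2 / 5 / (1 - γ) * 1 := by
      field_simp
      ring
    have hpos := critPoly_three_fifths_add_pos ht (sub_nonneg.2 hw)
    rw [hu, hv, critPoly_mul, add_sub_cancel] at hpos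
    exact pos_of_mul_pos_right hpos (by positivity)

theorem sum_erlangCoeff_eq_of_mul_eq {γ w n S D a b c : ℝ} (hγ : γ ≠ 0) (hw : w ≠ 0) (hn : n ≠ 0)
    (hD : D ≠ 0) (ha : 2 * γ * w * a = γ * S - D + w * n)
    (hb : w * b = a * (γ * S - D + 4 * γ * w ^ 2) + 2 * w * D - 2 * w ^ 2 * n)
    (hc : -(w * c) = b * (γ * S - D + 8 * γ * w ^ 2) + 8 * γ * w * a * D) (h : ℝ) :
    ∑ j ∈ Finset.range 4,
        erlangCoeff (S / (4 * w ^ 2)) (D / (4 * γ * w ^ 2)) (D / (w * n)) j * h ^ j =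
      D / (w * n) - 1 + 2 * γ * a / n * h + γ * w * b / (n * D) * h ^ 2 -
        γ * w ^ 2 * c / (3 * n * D ^ 2) * h ^ 3 := by
  obtain ⟨C, hC⟩ : ∃ C, C = erlangCoeff (S / (4 * w ^ 2)) (D / (4 * γ * w ^ 2)) (D / (w * n)) :=
    ⟨_, rfl⟩
  have hC0 : C 0 = D / (w * n) - 1 := by
    rw [hC, erlangCoeff]
  have hC1 : C 1 = 2 * γ * a / n := by
    rw [hC, erlangCoeff]
    field_simp
    linear_combination -D * ha
  have hC2 : C 2 = γ * w * b / (n * D) := by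
    rw [hC, erlangCoeff_add_two, ← hC, hC1, hC0]
    field_simp
    linear_combination -2 * hb
  have hC3 : C 3 = -(γ * w ^ 2 * c / (3 * n * D ^ 2)) := by
    rw [hC, erlangCoeff_add_two, ← hC, hC2, hC1]
    field_simp
    linear_combination -3 * hc
  simp only [← hC, Finset.sum_range_succ, Finset.sum_range_zero, hC0, hC1, hC2, hC3]
  ring

theorem sum_erlangCoeff_eq_critPoly_div {γ w D : ℝ} (hγ : γ ≠ 0) (hw : w ≠ 0) (hD : D ≠ 0)
    (hDw : D = (w ^ 2 + 1 - 2 * γ * w) * (γ * (w ^ 2 + 1) + w)) :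
    ∑ j ∈ Finset.range 4, erlangCoeff (((w ^ 2 - 1) / (2 * w)) ^ 2) (D / (4 * γ * w ^ 2))
        (D / (w * (w ^ 2 + 1))) j * (1 + (1 - 2 * γ ^ 2) / (2 * γ * w)) ^ j =
      2 * γ * ((w ^ 2 - 1) / (2 * w)) +
        critPoly γ 1 w / (24 * γ ^ 2 * w * (w ^ 2 + 1) * D ^ 2) := by
  obtain ⟨n, hn⟩ : ∃ n, n = w ^ 2 + 1 := ⟨_, rfl⟩
  obtain ⟨S, hS⟩ : ∃ S, S = (w ^ 2 - 1) ^ 2 := ⟨_, rfl⟩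
  obtain ⟨a, ha⟩ : ∃ a, a = γ * n - w := ⟨_, rfl⟩
  obtain ⟨e, he⟩ : ∃ e, e = 2 * γ * w + (1 - 2 * γ ^ 2) * n := ⟨_, rfl⟩
  obtain ⟨b, hb⟩ : ∃ b, b = 2 * γ * S - e * a := ⟨_, rfl⟩
  obtain ⟨c, hc⟩ : ∃ c, c = e * b - 8 * γ ^ 2 * S * (γ * n + w) := ⟨_, rfl⟩
  have hn0 : n ≠ 0 := by
    rw [hn]
    positivity
  have hcrit : critPoly γ 1 w =
      24 * γ ^ 2 * D ^ 2 *
          (D + a * (2 * γ * w - 2 * γ ^ 2 + 1) - w * n - γ * (w ^ 2 - 1) * n) +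
        6 * γ * (2 * γ * w - 2 * γ ^ 2 + 1) ^ 2 * b * D - (2 * γ * w - 2 * γ ^ 2 + 1) ^ 3 * c := by
    rw [hc, hb, he, ha, hDw, hS, hn, critPoly]
    ring
  rw [← hn] at hDw
  have hsq : ((w ^ 2 - 1) / (2 * w)) ^ 2 = S / (4 * w ^ 2) := by
    rw [hS]
    ring
  rw [hcrit, ← hn, hsq, sum_erlangCoeff_eq_of_mul_eq hγ hw hn0 hD (a := a) (b := b) (c := c)]
  · field_simp
    ring
  all_goals
    subst hc hb he ha hDw hS hn
    ring

section Step

variable {γ σ τ : ℝ}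

theorem eq_div_add_of_sq_eq_sq_add_one (hσ : 0 < σ + τ) (h : σ ^ 2 = τ ^ 2 + 1) :
    σ = ((σ + τ) ^ 2 + 1) / (2 * (σ + τ)) ∧ τ = ((σ + τ) ^ 2 - 1) / (2 * (σ + τ)) := by
  constructor <;> rw [eq_div_iff (by positivity)] <;> linarith

theorem criticalRate_sq_mul (hσ : σ ≠ 0) :
    criticalRate (σ ^ 2) (γ * σ) = (σ - γ) * (1 + 2 * γ * σ) / (2 * γ) := by
  rw [criticalRate]
  field_simp

theorem criticalRate_sq_mul_sub (hγ : γ ≠ 0) (hσ : σ ≠ 0) (hτ : τ ≠ 0) (hστ : σ + τ ≠ 0)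
    (h : σ ^ 2 = τ ^ 2 + 1) :
    criticalRate (σ ^ 2) (γ * σ) - criticalRate (τ ^ 2) (γ * τ) =
      1 + (1 - 2 * γ ^ 2) / (2 * γ * (σ + τ)) := by
  rw [criticalRate_sq_mul hσ, criticalRate_sq_mul hτ]
  field_simp
  linear_combination (1 - 2 * γ ^ 2 + 2 * γ * (σ + τ)) * h

theorem criticalRate_slope_le_one (hγ : 3 / 5 ≤ γ) (hγτ : γ < τ) (hγσ : γ < σ) (hτ2 : 2 ≤ τ ^ 2)
    (hστ : σ ^ 2 = τ ^ 2 + 1) :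
    (1 + (1 - 2 * γ ^ 2) / (2 * γ * (σ + τ))) *
      (1 - τ ^ 2 / criticalRate (σ ^ 2) (γ * σ)) ≤ 1 := by
  have hγ0 : 0 < γ := by linarith
  have hτ : 0 < τ := hγ0.trans hγτ
  have hσ : 0 < σ := hγ0.trans hγσ
  have hgap : 0 < σ - γ := sub_pos.2 hγσ
  have hL : 0 < criticalRate (σ ^ 2) (γ * σ) := by
    rw [criticalRate_sq_mul hσ.ne']
    positivity
  have hLτ : 2 * γ * (criticalRate (σ ^ 2) (γ * σ) - τ ^ 2) = σ * (1 - 2 * γ ^ 2) + γ := by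
    rw [criticalRate_sq_mul hσ.ne']
    field_simp
    linear_combination 2 * γ * hστ
  generalize criticalRate (σ ^ 2) (γ * σ) = L at hL hLτ
  have hw : 0 < 2 * γ * (σ + τ) := by positivity
  rw [one_sub_div hL.ne', one_add_div hw.ne', div_mul_div_comm, div_le_one (by positivity)]
  rcases le_total (1 - 2 * γ ^ 2) 0 with hk | hk
  · have hfac : 0 ≤ 2 * γ * (σ + τ) + (1 - 2 * γ ^ 2) := by
      linarith [mul_pos hγ0 hgap, mul_pos hγ0 hτ]
    calc (2 * γ * (σ + τ) + (1 - 2 * γ ^ 2)) * (L - τ ^ 2)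
        ≤ (2 * γ * (σ + τ) + (1 - 2 * γ ^ 2)) * L := by
          gcongr
          linarith
      _ ≤ 2 * γ * (σ + τ) * L := by
          gcongr
          linarith
  · have hγ2 : (3 / 5) ^ 2 ≤ γ ^ 2 := by gcongr
    have hk1 : 1 - 2 * γ ^ 2 ≤ 1 := by linarith [sq_nonneg γ]
    have hexcess : 2 * γ * ((1 - 2 * γ ^ 2) * (L - τ ^ 2)) ≤
        2 * γ * (2 * γ * (σ + τ) * τ ^ 2) :=
      calc 2 * γ * ((1 - 2 * γ ^ 2) * (L - τ ^ 2))
          = (1 - 2 * γ ^ 2) * (σ * (1 - 2 * γ ^ 2) + γ) := by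
            linear_combination (1 - 2 * γ ^ 2) * hLτ
        _ ≤ 1 * (σ * 1 + σ) := by gcongr
        _ ≤ 4 * (3 / 5) ^ 2 * (σ + τ) * 2 := by linarith
        _ ≤ 4 * γ ^ 2 * (σ + τ) * τ ^ 2 := by gcongr
        _ = 2 * γ * (2 * γ * (σ + τ) * τ ^ 2) := by ring
    linarith [le_of_mul_le_mul_left hexcess (by positivity)]

theorem two_mul_lt_sum_erlangCoeff_criticalRate (hγ : 3 / 5 ≤ γ) (hγτ : γ < τ) (hγσ : γ < σ)
    (hw3 : 3 ≤ σ + τ) (hστ : σ ^ 2 = τ ^ 2 + 1) :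
    2 * (γ * τ) < ∑ j ∈ Finset.range 4,
      erlangCoeff (τ ^ 2) (criticalRate (σ ^ 2) (γ * σ))
        (2 * γ * criticalRate (σ ^ 2) (γ * σ) / σ) j *
          (1 + (1 - 2 * γ ^ 2) / (2 * γ * (σ + τ))) ^ j := by
  have hγ0 : 0 < γ := by linarith
  have hσ : 0 < σ := hγ0.trans hγσ
  have hw0 : 0 < σ + τ := by linarith
  have hcrit : 0 < critPoly γ 1 (σ + τ) := critPoly_pos hγ (by linarith) hw3
  obtain ⟨hσw, hτw⟩ := eq_div_add_of_sq_eq_sq_add_one hw0 hστ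
  rw [criticalRate_sq_mul hσ.ne']
  have hgap : 0 < σ - γ := sub_pos.2 hγσ
  generalize σ + τ = w at hw0 hcrit hσw hτw
  subst hσw hτw
  obtain ⟨D, hD⟩ : ∃ D, D = (w ^ 2 + 1 - 2 * γ * w) * (γ * (w ^ 2 + 1) + w) := ⟨_, rfl⟩
  have hD0 : 0 < D := by
    have : 0 < w ^ 2 + 1 - 2 * γ * w := by
      rw [sub_pos, lt_div_iff₀ (by positivity)] at hgap
      linarith
    rw [hD]
    positivity
  have hrate : ((w ^ 2 + 1) / (2 * w) - γ) * (1 + 2 * γ * ((w ^ 2 + 1) / (2 * w))) / (2 * γ) =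
      D / (4 * γ * w ^ 2) := by
    rw [hD]
    field_simp
    ring
  have hvalue : 2 * γ * (D / (4 * γ * w ^ 2)) / ((w ^ 2 + 1) / (2 * w)) =
      D / (w * (w ^ 2 + 1)) := by
    field_simp
    ring
  rw [hrate, hvalue, sum_erlangCoeff_eq_critPoly_div hγ0.ne' hw0.ne' hD0.ne' hD, mul_assoc,
    lt_add_iff_pos_right]
  positivity

theorem lt_invErlangB_criticalRate_sq_of_le_succ {s : ℕ} (hγ : 3 / 5 ≤ γ) (hγτ : γ < τ)
    (hγσ : γ < σ) (hw3 : 3 ≤ σ + τ) (hs : s = τ ^ 2) (hs2 : 2 ≤ τ ^ 2) (hστ : σ ^ 2 = τ ^ 2 + 1)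
    (h : 1 + 2 * (γ * σ) ≤ invErlangB (s + 1) (criticalRate (σ ^ 2) (γ * σ))) :
    1 + 2 * (γ * τ) < invErlangB s (criticalRate (τ ^ 2) (γ * τ)) := by
  have hγ0 : 0 < γ := by linarith
  have hτ : 0 < τ := hγ0.trans hγτ
  have hσ : 0 < σ := hγ0.trans hγσ
  have hL {ρ : ℝ} (hρ : γ < ρ) : 0 < criticalRate (ρ ^ 2) (γ * ρ) := by
    have hρ0 : 0 < ρ := hγ0.trans hρ
    refine criticalRate_pos (mul_pos hγ0 hρ0) ?_
    rw [sq]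
    gcongr
  have hdrop : criticalRate (τ ^ 2) (γ * τ) =
      criticalRate (σ ^ 2) (γ * σ) - (1 + (1 - 2 * γ ^ 2) / (2 * γ * (σ + τ))) := by
    rw [← criticalRate_sq_mul_sub hγ0.ne' hσ.ne' hτ.ne' (by positivity) hστ, sub_sub_cancel]
  have hdrop0 : 0 ≤ 1 + (1 - 2 * γ ^ 2) / (2 * γ * (σ + τ)) := by
    rw [one_add_div (by positivity)]
    refine div_nonneg ?_ (by positivity)
    linarith [mul_pos hγ0 (sub_pos.2 hγσ), mul_pos hγ0 hτ]
  have hslope := criticalRate_slope_le_one hγ hγτ hγσ hs2 hστ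
  have hsum := two_mul_lt_sum_erlangCoeff_criticalRate hγ hγτ hγσ hw3 hστ
  have hLτ := hdrop ▸ hL hγτ
  rw [hdrop]
  have hLσ := hL hγσ
  generalize criticalRate (σ ^ 2) (γ * σ) = L at *
  have hvalue : 2 * γ * L / σ ≤ invErlangB s L := by
    rw [invErlangB_succ, add_le_add_iff_left, hs, ← hστ, div_mul_eq_mul_div, le_div_iff₀ hLσ] at h
    rw [div_le_iff₀ hσ]
    refine le_of_mul_le_mul_left ?_ hσ
    linarith
  refine lt_of_lt_of_le (add_lt_add_right (hsum.trans_le ?_) 1)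
    (one_add_sum_erlangCoeff_le_invErlangB s 3 hLσ hdrop0 (sub_pos.1 hLτ))
  rw [hs]
  exact sum_erlangCoeff_mono (sq_nonneg τ) hLσ hdrop0 hslope hvalue

end Step

theorem lt_invErlangB_criticalRate_of_le_succ {s : ℕ} {γ : ℝ} (hs : 2 ≤ s) (hγ : 3 / 5 ≤ γ)
    (hγs : γ < √(s : ℝ))
    (h : 1 + 2 * (γ * √((s + 1 : ℕ) : ℝ)) ≤
      invErlangB (s + 1) (criticalRate ((s + 1 : ℕ) : ℝ) (γ * √((s + 1 : ℕ) : ℝ)))) :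
    1 + 2 * (γ * √(s : ℝ)) < invErlangB s (criticalRate s (γ * √(s : ℝ))) := by
  have hs2 : (2 : ℝ) ≤ s := Nat.ofNat_le_cast.2 hs
  have hτ := Real.sq_sqrt (s.cast_nonneg (α := ℝ))
  have hσ := Real.sq_sqrt ((s + 1).cast_nonneg (α := ℝ))
  have hστ : √((s + 1 : ℕ) : ℝ) ^ 2 = √(s : ℝ) ^ 2 + 1 := by
    rw [hτ, hσ, Nat.cast_succ]
  have hlt : √(s : ℝ) < √((s + 1 : ℕ) : ℝ) :=
    Real.sqrt_lt_sqrt s.cast_nonneg (Nat.cast_lt.2 s.lt_succ_self)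
  have hw3 : 3 ≤ √((s + 1 : ℕ) : ℝ) + √(s : ℝ) := by
    have : 1.41 ≤ √(s : ℝ) := Real.le_sqrt_of_sq_le (by linarith)
    have : 1.73 ≤ √((s + 1 : ℕ) : ℝ) := Real.le_sqrt_of_sq_le (by push_cast; linarith)
    linarith
  have := lt_invErlangB_criticalRate_sq_of_le_succ hγ hγs (hγs.trans hlt) hw3 hτ.symm
    (hτ.symm ▸ hs2) hστ (by rwa [hσ])
  rwa [hτ] at this

theorem gammaHat_lt_succ_of_three_fifths_le {s : ℕ} (hs : 2 ≤ s) (h : 3 / 5 ≤ gammaHat s) :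
    gammaHat s < gammaHat (s + 1) := by
  have hs1 : 1 ≤ s := one_le_two.trans hs
  obtain ⟨h0, hlt⟩ := gammaHat_mem_Ioo hs1
  have hlt' : gammaHat s < √((s + 1 : ℕ) : ℝ) :=
    hlt.trans (Real.sqrt_lt_sqrt s.cast_nonneg (Nat.cast_lt.2 s.lt_succ_self))
  rw [lt_gammaHat_iff (Nat.le_add_left 1 s) ⟨h0, hlt'⟩]
  by_contra! hle
  exact (lt_invErlangB_criticalRate_of_le_succ hs h hlt hle).ne'
    (invErlangB_criticalRate_gammaHat hs1)

theorem three_fifths_le_gammaHat {s : ℕ} (hs : 2 ≤ s) : 3 / 5 ≤ gammaHat s := by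
  induction s, hs using Nat.le_induction with
  | base => exact three_fifths_lt_gammaHat_two.le
  | succ s hs ih => exact ih.trans (gammaHat_lt_succ_of_three_fifths_le hs ih).le

theorem gammaHat_lt_succ {s : ℕ} (hs : 1 ≤ s) : gammaHat s < gammaHat (s + 1) := by
  rcases hs.eq_or_lt with rfl | h
  · rw [gammaHat_one]
    exact lt_trans (by norm_num) three_fifths_lt_gammaHat_two
  · exact gammaHat_lt_succ_of_three_fifths_le h (three_fifths_le_gammaHat h)

theorem gammaHat_strictMonoOn : StrictMonoOn gammaHat (Ici 1) :=
  strictMonoOn_of_lt_succ ordConnected_Ici fun _ _ hs _ ↦ gammaHat_lt_succ hs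

end Monotonicity

/-! ### The Mills ratio -/

section MillsRatio

open MeasureTheory

theorem exp_mul_sub_sq_div_two_le (δ u : ℝ) :
    Real.exp (δ * u - u ^ 2 / 2) ≤ Real.exp ((δ + 1) ^ 2 / 2) * Real.exp (-u) := by
  rw [← Real.exp_add, Real.exp_le_exp]
  nlinarith [sq_nonneg (u - (δ + 1))]

theorem pow_mul_exp_mul_sub_sq_div_two_le (k : ℕ) (δ : ℝ) {u : ℝ} (hu : 0 ≤ u) :
    u ^ k * Real.exp (δ * u - u ^ 2 / 2) ≤
      Real.exp ((δ + 1) ^ 2 / 2) * (u ^ k * Real.exp (-u)) := by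
  rw [mul_left_comm]
  gcongr
  exact exp_mul_sub_sq_div_two_le δ u

theorem integrableOn_pow_mul_exp_neg_mul (k : ℕ) {b : ℝ} (hb : 0 < b) :
    IntegrableOn (fun u : ℝ ↦ u ^ k * Real.exp (-(b * u))) (Ioi 0) := by
  have hk : (-1 : ℝ) < k := neg_one_lt_zero.trans_le k.cast_nonneg
  simpa only [Real.rpow_natCast, Real.rpow_one, neg_mul] using
    integrableOn_rpow_mul_exp_neg_mul_rpow hk one_pos hb

theorem integrableOn_pow_mul_exp_mul_sub_sq_div_two (k : ℕ) (δ : ℝ) :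
    IntegrableOn (fun u : ℝ ↦ u ^ k * Real.exp (δ * u - u ^ 2 / 2)) (Ioi 0) := by
  have hdom := (integrableOn_pow_mul_exp_neg_mul k one_pos).const_mul (Real.exp ((δ + 1) ^ 2 / 2))
  simp only [one_mul] at hdom
  refine hdom.mono' (Continuous.aestronglyMeasurable (by fun_prop)) ?_
  filter_upwards [ae_restrict_mem measurableSet_Ioi] with u (hu : 0 < u)
  rw [Real.norm_of_nonneg (by positivity)]
  exact pow_mul_exp_mul_sub_sq_div_two_le k δ hu.le

theorem tendsto_pow_mul_exp_mul_sub_sq_div_two (k : ℕ) (δ : ℝ) :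
    Tendsto (fun u : ℝ ↦ u ^ k * Real.exp (δ * u - u ^ 2 / 2)) atTop (𝓝 0) := by
  have hlim := (Real.tendsto_pow_mul_exp_neg_atTop_nhds_zero k).const_mul
    (Real.exp ((δ + 1) ^ 2 / 2))
  rw [mul_zero] at hlim
  refine squeeze_zero' ?_ ?_ hlim <;> filter_upwards [eventually_ge_atTop 0] with u hu
  · positivity
  · exact pow_mul_exp_mul_sub_sq_div_two_le k δ hu

theorem integral_pos_of_ae_pos {α : Type*} {m : MeasurableSpace α} {μ : Measure α} [NeZero μ]
    {f : α → ℝ} (hf : Integrable f μ) (hpos : ∀ᵐ x ∂μ, 0 < f x) : 0 < ∫ x, f x ∂μ := by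
  rw [integral_pos_iff_support_of_nonneg_ae (hpos.mono fun _ ↦ le_of_lt) hf]
  have hsupp : Function.support f =ᵐ[μ] univ :=
    eventuallyEq_univ.2 (hpos.mono fun _ hx ↦ hx.ne')
  rw [measure_congr hsupp]
  exact pos_iff_ne_zero.2 (Measure.measure_univ_ne_zero.2 (NeZero.ne μ))

/-- The moments of the measure with density `exp (δ u - u² / 2)` on `(0, ∞)`, which up to a
constant factor is the normal law with mean `δ` and variance `1` truncated to `(0, ∞)`. -/
noncomputable def millsMoment (k : ℕ) (δ : ℝ) : ℝ :=
  ∫ u in Ioi (0 : ℝ), u ^ k * Real.exp (δ * u - u ^ 2 / 2)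

/-- The Mills ratio `Φ(δ) / φ(δ) = ∫_0^∞ exp (δ u - u² / 2) du` of the standard normal law (its
lower tail, so that it is an increasing function of `δ`). -/
noncomputable def millsRatio (δ : ℝ) : ℝ := millsMoment 0 δ

theorem millsMoment_pos (k : ℕ) (δ : ℝ) : 0 < millsMoment k δ := by
  have : NeZero (volume.restrict (Ioi (0 : ℝ))) := ⟨by simp⟩
  refine integral_pos_of_ae_pos (integrableOn_pow_mul_exp_mul_sub_sq_div_two k δ) ?_
  filter_upwards [ae_restrict_mem measurableSet_Ioi] with u (hu : 0 < u)
  positivity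

theorem millsRatio_pos (δ : ℝ) : 0 < millsRatio δ := millsMoment_pos 0 δ

/-- Integration by parts. At `k = 0` the truncated index `k - 1` is harmless because its
coefficient vanishes, and the boundary term `0 ^ k` equals `1`. -/
theorem millsMoment_succ (k : ℕ) (δ : ℝ) :
    millsMoment (k + 1) δ = k * millsMoment (k - 1) δ + δ * millsMoment k δ + 0 ^ k := by
  have hderiv : ∀ u : ℝ, HasDerivAt (fun u : ℝ ↦ u ^ k * Real.exp (δ * u - u ^ 2 / 2))
      (k * (u ^ (k - 1) * Real.exp (δ * u - u ^ 2 / 2)) +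
        δ * (u ^ k * Real.exp (δ * u - u ^ 2 / 2)) -
        u ^ (k + 1) * Real.exp (δ * u - u ^ 2 / 2)) u := fun u ↦ by
    have hexponent : HasDerivAt (fun u : ℝ ↦ δ * u - u ^ 2 / 2) (δ - u) u := by
      refine (((hasDerivAt_id u).const_mul δ).sub ((hasDerivAt_pow 2 u).div_const 2)).congr_deriv ?_
      simp
    refine ((hasDerivAt_pow k u).mul hexponent.exp).congr_deriv ?_
    ring
  have hint := integrableOn_pow_mul_exp_mul_sub_sq_div_two (δ := δ)
  have hlower := (hint (k - 1)).const_mul (k : ℝ)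
  have hsame := (hint k).const_mul δ
  have hparts := integral_Ioi_of_hasDerivAt_of_tendsto (a := 0)
    (hderiv 0).continuousAt.continuousWithinAt (fun u _ ↦ hderiv u)
    ((hlower.fun_add hsame).sub' (hint (k + 1))) (tendsto_pow_mul_exp_mul_sub_sq_div_two k δ)
  rw [integral_sub (hlower.fun_add hsame) (hint (k + 1)), integral_add hlower hsame,
    integral_const_mul, integral_const_mul] at hparts
  norm_num at hparts
  simp only [millsMoment]
  linarith

theorem millsMoment_one (δ : ℝ) : millsMoment 1 δ = 1 + δ * millsRatio δ := by
  rw [millsMoment_succ 0, millsRatio]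
  ring

theorem millsMoment_two (δ : ℝ) :
    millsMoment 2 δ = millsRatio δ + δ * (1 + δ * millsRatio δ) := by
  rw [millsMoment_succ 1, millsMoment_one, millsRatio]
  norm_num

theorem millsMoment_three (δ : ℝ) :
    millsMoment 3 δ =
      2 * (1 + δ * millsRatio δ) + δ * (millsRatio δ + δ * (1 + δ * millsRatio δ)) := by
  rw [millsMoment_succ 2, millsMoment_two, ← millsMoment_one]
  norm_num

theorem one_add_mul_millsRatio_pos (δ : ℝ) : 0 < 1 + δ * millsRatio δ :=
  millsMoment_one δ ▸ millsMoment_pos 1 δ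

theorem sq_millsMoment_one_lt (δ : ℝ) :
    millsMoment 1 δ ^ 2 < millsMoment 2 δ * millsRatio δ := by
  have hR := millsRatio_pos δ
  set mean := millsMoment 1 δ / millsRatio δ with hmean
  have hint := integrableOn_pow_mul_exp_mul_sub_sq_div_two (δ := δ)
  have hconst := (hint 0).const_mul (mean ^ 2)
  have hlinear := (hint 1).const_mul (2 * mean)
  have hexpand : ∀ u : ℝ, (u - mean) ^ 2 * Real.exp (δ * u - u ^ 2 / 2) =
      u ^ 2 * Real.exp (δ * u - u ^ 2 / 2) -
        2 * mean * (u ^ 1 * Real.exp (δ * u - u ^ 2 / 2)) +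
        mean ^ 2 * (u ^ 0 * Real.exp (δ * u - u ^ 2 / 2)) := fun u ↦ by ring
  have hvariance : 0 < ∫ u in Ioi (0 : ℝ), (u - mean) ^ 2 * Real.exp (δ * u - u ^ 2 / 2) := by
    have : NeZero (volume.restrict (Ioi (0 : ℝ))) := ⟨by simp⟩
    refine integral_pos_of_ae_pos ?_ ?_
    · simp only [hexpand]
      exact ((hint 2).sub' hlinear).fun_add hconst
    · filter_upwards [ae_restrict_of_ae (Measure.ae_ne volume mean)] with u hu
      have : u - mean ≠ 0 := sub_ne_zero.2 hu
      positivity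
  simp only [hexpand] at hvariance
  rw [integral_add (Integrable.sub' (hint 2) hlinear) hconst, integral_sub (hint 2) hlinear,
    integral_const_mul, integral_const_mul] at hvariance
  change 0 < millsMoment 2 δ - 2 * mean * millsMoment 1 δ + mean ^ 2 * millsRatio δ at hvariance
  have hcomplete : (millsMoment 2 δ - 2 * mean * millsMoment 1 δ + mean ^ 2 * millsRatio δ) *
      millsRatio δ = millsMoment 2 δ * millsRatio δ - millsMoment 1 δ ^ 2 := by
    rw [hmean]
    field_simp
    ring
  have := mul_pos hvariance hR
  linarith

theorem one_add_mul_millsRatio_lt_sq (δ : ℝ) : 1 + δ * millsRatio δ < millsRatio δ ^ 2 := by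
  have := sq_millsMoment_one_lt δ
  rw [millsMoment_one, millsMoment_two] at this
  linarith

theorem integral_Iic_eq_integral_Ioi_sub (f : ℝ → ℝ) (x : ℝ) :
    ∫ t in Iic x, f t = ∫ u in Ioi (0 : ℝ), f (x - u) := by
  rw [← integral_Ici_eq_integral_Ioi, ← integral_indicator measurableSet_Iic,
    ← integral_indicator measurableSet_Ici, ← integral_sub_left_eq_self _ volume x]
  simp only [indicator, mem_Iic, mem_Ici, sub_le_self_iff]

theorem integral_Iic_exp_neg_sq_div_two (δ : ℝ) :
    ∫ t in Iic δ, Real.exp (-t ^ 2 / 2) = Real.exp (-δ ^ 2 / 2) * millsRatio δ := by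
  rw [integral_Iic_eq_integral_Ioi_sub, millsRatio, millsMoment, ← integral_const_mul]
  congr 1 with u
  rw [pow_zero, one_mul, ← Real.exp_add]
  ring_nf

theorem integrable_exp_neg_sq_div_two : Integrable (fun t : ℝ ↦ Real.exp (-t ^ 2 / 2)) := by
  convert integrable_exp_neg_mul_sq (b := 1 / 2) (by norm_num) using 3
  ring

theorem hasDerivAt_integral_Iic {f : ℝ → ℝ} (hf : Integrable f) (hc : Continuous f) (x : ℝ) :
    HasDerivAt (fun x ↦ ∫ t in Iic x, f t) (f x) x := by
  refine ((intervalIntegral.integral_hasDerivAt_right (hc.intervalIntegrable 0 x)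
    (hc.stronglyMeasurableAtFilter _ _) hc.continuousAt).const_add
    (∫ t in Iic 0, f t)).congr_of_eventuallyEq (Eventually.of_forall fun y ↦ ?_)
  simp only [← intervalIntegral.integral_Iic_sub_Iic hf.integrableOn hf.integrableOn]
  ring

theorem exp_sq_div_two_mul_exp_neg_sq_div_two (x : ℝ) :
    Real.exp (x ^ 2 / 2) * Real.exp (-x ^ 2 / 2) = 1 := by
  rw [← Real.exp_add, neg_div, add_neg_cancel, Real.exp_zero]

theorem hasDerivAt_exp_neg_sq_div_two (x : ℝ) :
    HasDerivAt (fun x : ℝ ↦ Real.exp (-x ^ 2 / 2)) (Real.exp (-x ^ 2 / 2) * -x) x :=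
  HasDerivAt.exp (((hasDerivAt_pow 2 x).neg.div_const 2).congr_deriv (by push_cast; ring))

theorem hasDerivAt_millsRatio (δ : ℝ) : HasDerivAt millsRatio (1 + δ * millsRatio δ) δ := by
  have hquot : ∀ x, millsRatio x =
      (∫ t in Iic x, Real.exp (-t ^ 2 / 2)) / Real.exp (-x ^ 2 / 2) := fun x ↦ by
    rw [integral_Iic_exp_neg_sq_div_two, mul_div_cancel_left₀ _ (Real.exp_pos _).ne']
  refine (((hasDerivAt_integral_Iic integrable_exp_neg_sq_div_two (by fun_prop) δ).div
    (hasDerivAt_exp_neg_sq_div_two δ) (Real.exp_pos _).ne').congr_of_eventuallyEq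
    (Eventually.of_forall hquot)).congr_deriv ?_
  rw [hquot]
  field_simp
  ring

theorem millsRatio_strictMono : StrictMono millsRatio := strictMono_of_deriv_pos fun δ ↦ by
  rw [(hasDerivAt_millsRatio δ).deriv]
  exact one_add_mul_millsRatio_pos δ

theorem millsRatio_zero : millsRatio 0 = √(Real.pi / 2) := by
  have hgauss : millsRatio 0 = ∫ x in Ioi (0 : ℝ), Real.exp (-(1 / 2) * x ^ 2) := by
    rw [millsRatio, millsMoment]
    congr 1 with u
    ring_nf
  rw [hgauss, integral_gaussian_Ioi, show Real.pi / (1 / 2) = Real.pi / 2 * 2 ^ 2 by ring,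
    Real.sqrt_mul (by positivity), Real.sqrt_sq (by norm_num)]
  ring

theorem fInfty_eq_inv_millsRatio (δ : ℝ) : fInfty δ = (millsRatio δ)⁻¹ := by
  have hcdf : ProbabilityTheory.cdf (ProbabilityTheory.gaussianReal 0 1) δ =
      ∫ x in Iic δ, ProbabilityTheory.gaussianPDFReal 0 1 x := by
    rw [ProbabilityTheory.cdf_eq_real, measureReal_def,
      ProbabilityTheory.gaussianReal_apply_eq_integral 0 one_ne_zero, ENNReal.toReal_ofReal]
    exact integral_nonneg fun x ↦ ProbabilityTheory.gaussianPDFReal_nonneg 0 1 x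
  have hpdf : ∀ x : ℝ, ProbabilityTheory.gaussianPDFReal 0 1 x =
      (√(2 * Real.pi))⁻¹ * Real.exp (-x ^ 2 / 2) := fun x ↦ by
    simp [ProbabilityTheory.gaussianPDFReal]
  have hR := millsRatio_pos δ
  have : 0 < √(2 * Real.pi) := by positivity
  rw [fInfty, hcdf]
  simp only [hpdf]
  rw [integral_const_mul, integral_Iic_exp_neg_sq_div_two]
  field_simp

theorem fInfty_pos (δ : ℝ) : 0 < fInfty δ :=
  fInfty_eq_inv_millsRatio δ ▸ inv_pos.2 (millsRatio_pos δ)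

end MillsRatio

/-! ### The limiting Cohen equation -/

section CohenInfty

variable {γ δ : ℝ}

/-- The mean `δ + φ(δ) / Φ(δ)` of the normal law with mean `δ` and variance `1` truncated to
`(0, ∞)`. -/
noncomputable def truncNormalMean (δ : ℝ) : ℝ := δ + fInfty δ

/-- The amount `1 - Var` by which truncation to `(0, ∞)` lowers the variance of the normal law with
mean `δ` and variance `1`. -/
noncomputable def truncNormalVarDrop (δ : ℝ) : ℝ := truncNormalMean δ * fInfty δ

/-- The third cumulant of the normal law with mean `δ` and variance `1` truncated to `(0, ∞)`,
multiplied by `exp (-δ² / 2) * millsRatio δ ^ 4`, which makes its derivative manifestly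
positive. -/
noncomputable def truncNormalSkew (δ : ℝ) : ℝ :=
  Real.exp (-δ ^ 2 / 2) * (millsRatio δ *
    ((1 + δ * millsRatio δ) ^ 2 + (1 + δ * millsRatio δ) - millsRatio δ ^ 2))

theorem truncNormalMean_eq_div (δ : ℝ) :
    truncNormalMean δ = (1 + δ * millsRatio δ) / millsRatio δ := by
  have := millsRatio_pos δ
  rw [truncNormalMean, fInfty_eq_inv_millsRatio]
  field_simp
  ring

theorem truncNormalMean_pos (δ : ℝ) : 0 < truncNormalMean δ :=
  truncNormalMean_eq_div δ ▸ div_pos (one_add_mul_millsRatio_pos δ) (millsRatio_pos δ)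

theorem one_add_mul_truncNormalMean_pos (δ : ℝ) : 0 < 1 + δ * truncNormalMean δ := by
  have hR := millsRatio_pos δ
  have hmoment : 1 + δ * truncNormalMean δ = millsMoment 2 δ / millsRatio δ := by
    rw [truncNormalMean_eq_div, millsMoment_two]
    field_simp
  exact hmoment ▸ div_pos (millsMoment_pos 2 δ) hR

theorem sq_add_two_mul_truncNormalMean_add_pos (δ : ℝ) :
    0 < (2 + δ ^ 2) * truncNormalMean δ + δ := by
  have hR := millsRatio_pos δ
  have hmoment : (2 + δ ^ 2) * truncNormalMean δ + δ = millsMoment 3 δ / millsRatio δ := by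
    rw [truncNormalMean_eq_div, millsMoment_three]
    field_simp
    ring
  exact hmoment ▸ div_pos (millsMoment_pos 3 δ) hR

theorem hasDerivAt_fInfty (δ : ℝ) : HasDerivAt fInfty (-truncNormalVarDrop δ) δ := by
  have hR := millsRatio_pos δ
  refine (((hasDerivAt_millsRatio δ).inv hR.ne').congr_of_eventuallyEq
    (Eventually.of_forall fInfty_eq_inv_millsRatio)).congr_deriv ?_
  rw [truncNormalVarDrop, truncNormalMean_eq_div, fInfty_eq_inv_millsRatio]
  field_simp

theorem hasDerivAt_truncNormalMean (δ : ℝ) :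
    HasDerivAt truncNormalMean (1 - truncNormalVarDrop δ) δ :=
  (hasDerivAt_id δ).add (hasDerivAt_fInfty δ)

theorem truncNormalVarDrop_pos (δ : ℝ) : 0 < truncNormalVarDrop δ :=
  mul_pos (truncNormalMean_pos δ) (fInfty_pos δ)

theorem truncNormalVarDrop_lt_one (δ : ℝ) : truncNormalVarDrop δ < 1 := by
  have hR := millsRatio_pos δ
  have hvar := one_add_mul_millsRatio_lt_sq δ
  rw [truncNormalVarDrop, truncNormalMean_eq_div, fInfty_eq_inv_millsRatio, ← div_eq_mul_inv,
    div_div, div_lt_one (by positivity)]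
  linarith

theorem truncNormalMean_strictMono : StrictMono truncNormalMean :=
  strictMono_of_deriv_pos fun δ ↦ by
    rw [(hasDerivAt_truncNormalMean δ).deriv]
    exact sub_pos.2 (truncNormalVarDrop_lt_one δ)

theorem exists_truncNormalMean_eq (hγ : 0 < γ) : ∃ δ, truncNormalMean δ = γ := by
  have hcont : Continuous truncNormalMean :=
    continuous_iff_continuousAt.2 fun δ ↦ (hasDerivAt_truncNormalMean δ).continuousAt
  refine mem_range_of_exists_le_of_exists_ge hcont ⟨-γ⁻¹, ?_⟩ ⟨γ, ?_⟩
  · have hpos := mul_pos hγ (one_add_mul_truncNormalMean_pos (-γ⁻¹))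
    rw [mul_add, mul_one, neg_mul, mul_neg, mul_inv_cancel_left₀ hγ.ne'] at hpos
    linarith
  · exact le_add_of_nonneg_right (fInfty_pos γ).le

theorem existsUnique_eq_fInfty_sub (hγ : 0 < γ) : ∃! a : ℝ, a = fInfty (γ - a) := by
  have heq_iff : ∀ a, a = fInfty (γ - a) ↔ truncNormalMean (γ - a) = γ := fun a ↦ by
    rw [truncNormalMean, sub_add, sub_eq_self, sub_eq_zero]
  obtain ⟨δ, hδ⟩ := exists_truncNormalMean_eq hγ
  simp only [heq_iff]
  refine ⟨γ - δ, by simpa only [sub_sub_cancel] using hδ, fun a ha ↦ ?_⟩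
  rw [← truncNormalMean_strictMono.injective (ha.trans hδ.symm), sub_sub_cancel]

theorem cohenAInfty_eq_fInfty (hγ : 0 < γ) : cohenAInfty γ = fInfty (γ - cohenAInfty γ) :=
  Classical.epsilon_spec (existsUnique_eq_fInfty_sub hγ).exists

theorem truncNormalMean_sub_cohenAInfty (hγ : 0 < γ) :
    truncNormalMean (γ - cohenAInfty γ) = γ := by
  rw [truncNormalMean, ← cohenAInfty_eq_fInfty hγ, sub_add_cancel]

theorem mul_cohenAInfty_eq_truncNormalVarDrop (hγ : 0 < γ) :
    γ * cohenAInfty γ = truncNormalVarDrop (γ - cohenAInfty γ) := by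
  rw [truncNormalVarDrop, truncNormalMean_sub_cohenAInfty hγ, ← cohenAInfty_eq_fInfty hγ]

theorem truncNormalMean_mul_cohenAInfty (δ : ℝ) :
    truncNormalMean δ * cohenAInfty (truncNormalMean δ) = truncNormalVarDrop δ := by
  have hmean := truncNormalMean_pos δ
  rw [mul_cohenAInfty_eq_truncNormalVarDrop hmean,
    truncNormalMean_strictMono.injective (truncNormalMean_sub_cohenAInfty hmean)]

theorem hasDerivAt_truncNormalSkew (δ : ℝ) :
    HasDerivAt truncNormalSkew (Real.exp (-δ ^ 2 / 2) * (2 * (1 + δ * millsRatio δ) ^ 3)) δ := by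
  have hR := hasDerivAt_millsRatio δ
  have hR' := ((hasDerivAt_id δ).mul hR).const_add 1
  refine ((hasDerivAt_exp_neg_sq_div_two δ).mul
    (hR.mul (((hR'.pow 2).add hR').sub (hR.pow 2)))).congr_deriv ?_
  simp only [Pi.mul_apply, Pi.add_apply, Pi.sub_apply, Pi.pow_apply, id]
  push_cast
  ring

theorem truncNormalSkew_strictMono : StrictMono truncNormalSkew :=
  strictMono_of_deriv_pos fun δ ↦ by
    have := one_add_mul_millsRatio_pos δ
    rw [(hasDerivAt_truncNormalSkew δ).deriv]
    positivity

theorem neg_exp_neg_sq_div_two_le_truncNormalSkew (hδ : δ ≤ -1) :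
    -Real.exp (-δ ^ 2 / 2) ≤ truncNormalSkew δ := by
  have hR := millsRatio_pos δ
  have hR' := one_add_mul_millsRatio_pos δ
  have hR_le : millsRatio δ ≤ 1 := by nlinarith
  have hcube : millsRatio δ ^ 3 ≤ 1 := pow_le_one₀ hR.le hR_le
  have : 0 < millsRatio δ * ((1 + δ * millsRatio δ) ^ 2 + (1 + δ * millsRatio δ)) := by
    positivity
  rw [truncNormalSkew, ← mul_neg_one]
  gcongr
  linarith

theorem tendsto_sq_atBot_atTop {R : Type*} [Ring R] [LinearOrder R] [IsStrictOrderedRing R] :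
    Tendsto (fun x : R ↦ x ^ 2) atBot atTop := by
  simp only [sq]
  exact tendsto_id.atBot_mul_atBot₀ tendsto_id

theorem tendsto_exp_neg_sq_div_two_atBot :
    Tendsto (fun x : ℝ ↦ Real.exp (-x ^ 2 / 2)) atBot (𝓝 0) := by
  have hsq : Tendsto (fun x : ℝ ↦ x ^ 2 / 2) atBot atTop :=
    tendsto_sq_atBot_atTop.atTop_div_const two_pos
  simpa only [Function.comp_def, neg_div] using Real.tendsto_exp_neg_atTop_nhds_zero.comp hsq

theorem truncNormalSkew_pos (δ : ℝ) : 0 < truncNormalSkew δ := by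
  have hlim := tendsto_exp_neg_sq_div_two_atBot.neg
  rw [neg_zero] at hlim
  have hnonneg : 0 ≤ truncNormalSkew (δ - 1) := by
    refine le_of_tendsto hlim ?_
    filter_upwards [eventually_le_atBot (δ - 1), eventually_le_atBot (-1)] with x hx hx'
    exact (neg_exp_neg_sq_div_two_le_truncNormalSkew hx').trans
      (truncNormalSkew_strictMono.monotone hx)
  exact hnonneg.trans_lt (truncNormalSkew_strictMono (sub_one_lt δ))

theorem hasDerivAt_truncNormalVarDrop (δ : ℝ) :
    HasDerivAt truncNormalVarDrop
      (-(truncNormalSkew δ / (Real.exp (-δ ^ 2 / 2) * millsRatio δ ^ 4))) δ := by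
  have hR := millsRatio_pos δ
  refine ((hasDerivAt_truncNormalMean δ).mul (hasDerivAt_fInfty δ)).congr_deriv ?_
  rw [truncNormalSkew, truncNormalVarDrop, truncNormalMean_eq_div, fInfty_eq_inv_millsRatio]
  field_simp
  ring

theorem truncNormalVarDrop_strictAnti : StrictAnti truncNormalVarDrop :=
  strictAnti_of_deriv_neg fun δ ↦ by
    have hR := millsRatio_pos δ
    have hskew := truncNormalSkew_pos δ
    rw [(hasDerivAt_truncNormalVarDrop δ).deriv, neg_lt_zero]
    positivity

theorem sub_cohenAInfty_strictMonoOn : StrictMonoOn (fun γ ↦ γ - cohenAInfty γ) (Ioi 0) := by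
  intro x hx y hy hxy
  refine truncNormalMean_strictMono.lt_iff_lt.1 ?_
  simpa only [truncNormalMean_sub_cohenAInfty hx, truncNormalMean_sub_cohenAInfty hy] using hxy

theorem mul_cohenAInfty_strictAntiOn :
    StrictAntiOn (fun γ : ℝ ↦ γ * cohenAInfty γ) (Ioi 0) :=
  (truncNormalVarDrop_strictAnti.comp_strictMonoOn sub_cohenAInfty_strictMonoOn).congr
    fun _ hγ ↦ (mul_cohenAInfty_eq_truncNormalVarDrop hγ).symm

theorem tendsto_sub_cohenAInfty_zero :
    Tendsto (fun γ ↦ γ - cohenAInfty γ) (𝓝[>] 0) atBot := by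
  refine tendsto_atBot.2 fun b ↦ ?_
  filter_upwards [Ioo_mem_nhdsGT (truncNormalMean_pos b)] with γ ⟨hγ, hγb⟩
  rw [← truncNormalMean_strictMono.le_iff_le, truncNormalMean_sub_cohenAInfty hγ]
  exact hγb.le

theorem tendsto_sub_cohenAInfty_atTop :
    Tendsto (fun γ ↦ γ - cohenAInfty γ) atTop atTop := by
  refine tendsto_atTop.2 fun b ↦ ?_
  filter_upwards [eventually_ge_atTop (truncNormalMean b), eventually_gt_atTop 0] with γ hγb hγ
  rwa [← truncNormalMean_strictMono.le_iff_le, truncNormalMean_sub_cohenAInfty hγ]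

theorem one_sub_le_truncNormalVarDrop (hδ : δ ≤ 0) :
    1 - 2 / (2 + δ ^ 2) ≤ truncNormalVarDrop δ := by
  have hmean := truncNormalMean_pos δ
  have hmean_ge := sq_add_two_mul_truncNormalMean_add_pos δ
  have hfInfty : -δ ≤ fInfty δ := by
    rw [truncNormalMean] at hmean
    linarith
  rw [show 1 - 2 / (2 + δ ^ 2) = δ ^ 2 / (2 + δ ^ 2) by field_simp; ring,
    div_le_iff₀ (by positivity), truncNormalVarDrop]
  nlinarith [mul_le_mul_of_nonneg_left hfInfty hmean.le]

theorem tendsto_truncNormalVarDrop_atBot : Tendsto truncNormalVarDrop atBot (𝓝 1) := by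
  have hlim : Tendsto (fun δ : ℝ ↦ 1 - 2 / (2 + δ ^ 2)) atBot (𝓝 1) := by
    have hsq : Tendsto (fun δ : ℝ ↦ 2 + δ ^ 2) atBot atTop :=
      tendsto_atTop_add_const_left _ _ tendsto_sq_atBot_atTop
    simpa using (tendsto_const_nhds.div_atTop hsq).const_sub 1
  refine tendsto_of_tendsto_of_tendsto_of_le_of_le' hlim tendsto_const_nhds ?_
    (Eventually.of_forall fun δ ↦ (truncNormalVarDrop_lt_one δ).le)
  filter_upwards [eventually_le_atBot 0] with δ hδ
  exact one_sub_le_truncNormalVarDrop hδ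

theorem tendsto_mul_cohenAInfty_zero :
    Tendsto (fun γ : ℝ ↦ γ * cohenAInfty γ) (𝓝[>] 0) (𝓝 1) := by
  refine (tendsto_truncNormalVarDrop_atBot.comp tendsto_sub_cohenAInfty_zero).congr' ?_
  filter_upwards [self_mem_nhdsWithin] with γ hγ
  exact (mul_cohenAInfty_eq_truncNormalVarDrop hγ).symm

theorem cmp_millsRatio_sub_inv (hγ : 0 < γ) :
    cmp (millsRatio (γ - (2 * γ)⁻¹)) (2 * γ) = cmp (1 / 2) (γ * cohenAInfty γ) := by
  have hR := millsRatio_pos (γ - (2 * γ)⁻¹)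
  have hmean : cmp (millsRatio (γ - (2 * γ)⁻¹)) (2 * γ) =
      cmp γ (truncNormalMean (γ - (2 * γ)⁻¹)) := by
    refine cmp_eq_cmp_of_sub_eq_mul
      (k := 2 * γ * millsRatio (γ - (2 * γ)⁻¹)) (by positivity) ?_
    rw [truncNormalMean, fInfty_eq_inv_millsRatio]
    generalize millsRatio (γ - (2 * γ)⁻¹) = R at hR ⊢
    field_simp
    ring
  have harg : cmp (γ - cohenAInfty γ) (γ - (2 * γ)⁻¹) = cmp (1 / 2) (γ * cohenAInfty γ) := by
    refine cmp_eq_cmp_of_sub_eq_mul (k := γ⁻¹) (by positivity) ?_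
    field_simp
    ring
  rw [hmean, ← harg, ← truncNormalMean_strictMono.cmp_map_eq (γ - cohenAInfty γ),
    truncNormalMean_sub_cohenAInfty hγ]

end CohenInfty

section MillsSeries

variable {δ : ℝ}

theorem exp_mul_le_of_mul_le_deriv {D D' : ℝ → ℝ} (hδ : 0 ≤ δ) (hD : ∀ x, HasDerivAt D (D' x) x)
    (hD' : ∀ x ∈ Ioo 0 δ, x * D x ≤ D' x) : Real.exp (δ ^ 2 / 2) * D 0 ≤ D δ := by
  have hderiv : ∀ x, HasDerivAt (fun x ↦ Real.exp (-x ^ 2 / 2) * D x)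
      (Real.exp (-x ^ 2 / 2) * (D' x - x * D x)) x := fun x ↦
    ((hasDerivAt_exp_neg_sq_div_two x).mul (hD x)).congr_deriv (by ring)
  have hmono : MonotoneOn (fun x ↦ Real.exp (-x ^ 2 / 2) * D x) (Icc 0 δ) := by
    refine monotoneOn_of_deriv_nonneg (convex_Icc 0 δ)
      (fun x _ ↦ (hderiv x).continuousAt.continuousWithinAt)
      (fun x _ ↦ (hderiv x).differentiableAt.differentiableWithinAt) fun x hx ↦ ?_
    rw [interior_Icc] at hx
    rw [(hderiv x).deriv]
    exact mul_nonneg (Real.exp_pos _).le (sub_nonneg.2 (hD' x hx))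
  have hends : D 0 ≤ Real.exp (-δ ^ 2 / 2) * D δ := by
    simpa using hmono (left_mem_Icc.2 hδ) (right_mem_Icc.2 hδ) hδ
  calc Real.exp (δ ^ 2 / 2) * D 0
      ≤ Real.exp (δ ^ 2 / 2) * (Real.exp (-δ ^ 2 / 2) * D δ) := by gcongr
    _ = D δ := by rw [← mul_assoc, exp_sq_div_two_mul_exp_neg_sq_div_two, one_mul]

theorem exp_mul_millsRatio_zero_le (hδ : 0 ≤ δ) :
    Real.exp (δ ^ 2 / 2) * millsRatio 0 ≤ millsRatio δ :=
  exp_mul_le_of_mul_le_deriv hδ hasDerivAt_millsRatio fun _ _ ↦ le_add_of_nonneg_left zero_le_one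

theorem one_le_millsRatio_zero : 1 ≤ millsRatio 0 := by
  rw [millsRatio_zero, Real.one_le_sqrt]
  linarith [Real.pi_gt_three]

theorem tendsto_truncNormalVarDrop_atTop : Tendsto truncNormalVarDrop atTop (𝓝 0) := by
  have hlim : Tendsto (fun δ : ℝ ↦ 6 / δ) atTop (𝓝 0) := tendsto_const_nhds.div_atTop tendsto_id
  refine squeeze_zero' (Eventually.of_forall fun δ ↦ (truncNormalVarDrop_pos δ).le) ?_ hlim
  filter_upwards [eventually_ge_atTop 1] with δ hδ
  have : 0 < δ := by positivity
  have hR : δ ^ 2 / 2 ≤ millsRatio δ :=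
    calc δ ^ 2 / 2 ≤ Real.exp (δ ^ 2 / 2) * 1 := by linarith [Real.add_one_le_exp (δ ^ 2 / 2)]
      _ ≤ Real.exp (δ ^ 2 / 2) * millsRatio 0 := by gcongr; exact one_le_millsRatio_zero
      _ ≤ millsRatio δ := exp_mul_millsRatio_zero_le (zero_le_one.trans hδ)
  have hfInfty : fInfty δ ≤ 2 / δ ^ 2 := by
    rw [fInfty_eq_inv_millsRatio, ← inv_div]
    gcongr
  have hfInfty_le_two : fInfty δ ≤ 2 := hfInfty.trans (div_le_self two_pos.le (one_le_pow₀ hδ))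
  calc truncNormalVarDrop δ = (δ + fInfty δ) * fInfty δ := rfl
    _ ≤ (3 * δ) * (2 / δ ^ 2) := by
        have := fInfty_pos δ
        gcongr
        linarith
    _ = 6 / δ := by
        field_simp
        norm_num

theorem tendsto_mul_cohenAInfty_atTop :
    Tendsto (fun γ : ℝ ↦ γ * cohenAInfty γ) atTop (𝓝 0) := by
  refine (tendsto_truncNormalVarDrop_atTop.comp tendsto_sub_cohenAInfty_atTop).congr' ?_
  filter_upwards [eventually_gt_atTop 0] with γ hγ
  exact (mul_cohenAInfty_eq_truncNormalVarDrop hγ).symm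

/-- The terms of the power series solution of `y' = 1 + x y`, `y 0 = 0`, the differential equation
satisfied by the Mills ratio. -/
noncomputable def millsTerm (n : ℕ) (x : ℝ) : ℝ :=
  x ^ (2 * n + 1) / (Nat.doubleFactorial (2 * n + 1) : ℝ)

/-- The partial sums of the power series solution of `y' = 1 + x y`, `y 0 = 0`. -/
noncomputable def millsSum (n : ℕ) (x : ℝ) : ℝ :=
  ∑ k ∈ Finset.range n, millsTerm k x

theorem millsTerm_nonneg (n : ℕ) {x : ℝ} (hx : 0 ≤ x) : 0 ≤ millsTerm n x := by
  unfold millsTerm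
  positivity

theorem millsTerm_succ (n : ℕ) (x : ℝ) :
    millsTerm (n + 1) x = x ^ 2 / (2 * n + 3) * millsTerm n x := by
  have : (Nat.doubleFactorial (2 * n + 1) : ℝ) ≠ 0 := by positivity
  rw [millsTerm, millsTerm, show 2 * (n + 1) + 1 = 2 * n + 1 + 2 by ring,
    Nat.doubleFactorial_add_two]
  push_cast
  field_simp
  ring

theorem hasDerivAt_millsTerm_zero (x : ℝ) : HasDerivAt (millsTerm 0) 1 x := by
  have hid : millsTerm 0 = id := by
    ext y
    simp [millsTerm]
  exact hid ▸ hasDerivAt_id x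

theorem hasDerivAt_millsTerm_succ (n : ℕ) (x : ℝ) :
    HasDerivAt (millsTerm (n + 1)) (x * millsTerm n x) x := by
  refine ((hasDerivAt_pow (2 * (n + 1) + 1) x).div_const _).congr_deriv ?_
  have : (Nat.doubleFactorial (2 * n + 1) : ℝ) ≠ 0 := by positivity
  rw [millsTerm, show 2 * (n + 1) + 1 = 2 * n + 1 + 2 by ring, Nat.doubleFactorial_add_two]
  push_cast
  field_simp
  ring_nf

theorem hasDerivAt_millsSum_succ (n : ℕ) (x : ℝ) :
    HasDerivAt (millsSum (n + 1)) (1 + x * millsSum n x) x := by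
  have hsum : HasDerivAt (∑ k ∈ Finset.range (n + 1), millsTerm k)
      (∑ k ∈ Finset.range n, x * millsTerm k x + 1) x := by
    rw [Finset.sum_range_succ']
    exact (HasDerivAt.sum fun k _ ↦ hasDerivAt_millsTerm_succ k x).add (hasDerivAt_millsTerm_zero x)
  refine (hsum.congr_of_eventuallyEq (Eventually.of_forall fun y ↦ ?_)).congr_deriv ?_
  · rw [millsSum, Finset.sum_apply]
  · rw [millsSum, Finset.mul_sum, add_comm]

theorem millsSum_zero_right (n : ℕ) : millsSum n 0 = 0 := by
  simp [millsSum, millsTerm]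

theorem exp_mul_add_millsSum_le_millsRatio (n : ℕ) (hδ : 0 ≤ δ) :
    Real.exp (δ ^ 2 / 2) * √(Real.pi / 2) + millsSum (n + 1) δ ≤ millsRatio δ := by
  have hcompare := exp_mul_le_of_mul_le_deriv hδ
    (fun x ↦ (hasDerivAt_millsRatio x).sub (hasDerivAt_millsSum_succ n x)) fun x hx ↦ by
      have hterm := mul_nonneg hx.1.le (millsTerm_nonneg n hx.1.le)
      rw [Pi.sub_apply, millsSum, Finset.sum_range_succ, ← millsSum]
      linarith
  rw [Pi.sub_apply, Pi.sub_apply, millsSum_zero_right, sub_zero, millsRatio_zero] at hcompare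
  linarith

theorem millsRatio_le_exp_mul_add_millsSum (n : ℕ) (hδ : 0 ≤ δ) (hδ1 : δ ≤ 1) :
    millsRatio δ ≤ Real.exp (δ ^ 2 / 2) * √(Real.pi / 2) + millsSum (n + 1) δ +
      (1 + 1 / (2 * (n + 1))) * millsTerm (n + 1) δ := by
  have hcompare := exp_mul_le_of_mul_le_deriv hδ
    (fun x ↦ ((hasDerivAt_millsSum_succ n x).add
      ((hasDerivAt_millsTerm_succ n x).const_mul (1 + 1 / (2 * (n + 1)) : ℝ))).sub
      (hasDerivAt_millsRatio x)) fun x hx ↦ by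
        have hterm := mul_nonneg hx.1.le (millsTerm_nonneg n hx.1.le)
        have hx2 : x ^ 2 ≤ 1 := pow_le_one₀ hx.1.le (hx.2.le.trans hδ1)
        have hratio : (1 + 1 / (2 * (n + 1)) : ℝ) * (x ^ 2 / (2 * n + 3)) ≤ 1 / (2 * (n + 1)) :=
          calc (1 + 1 / (2 * (n + 1)) : ℝ) * (x ^ 2 / (2 * n + 3))
              ≤ (1 + 1 / (2 * (n + 1))) * (1 / (2 * n + 3)) := by gcongr
            _ = 1 / (2 * (n + 1)) := by field_simp; ring
        have := mul_le_mul_of_nonneg_right hratio hterm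
        simp only [Pi.sub_apply, Pi.add_apply, millsTerm_succ, millsSum, Finset.sum_range_succ]
        linarith
  simp only [Pi.sub_apply, Pi.add_apply, millsSum_zero_right, millsTerm_succ, millsRatio_zero,
    zero_pow two_ne_zero, zero_div, zero_mul, mul_zero, add_zero, zero_sub] at hcompare
  rw [millsTerm_succ]
  linarith

end MillsSeries

/-! ### Numerical enclosure of the limit -/

theorem lt_sqrt_pi_div_two : (1.2533141373155 : ℝ) < √(Real.pi / 2) := by
  refine Real.lt_sqrt_of_sq_lt ?_
  linarith [Real.pi_gt_d20]

theorem sqrt_pi_div_two_lt : √(Real.pi / 2) < (1.2533141373156 : ℝ) := by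
  rw [Real.sqrt_lt' (by norm_num)]
  linarith [Real.pi_lt_d20]

theorem millsRatio_lt_at_lower_bound :
    millsRatio (1.034113459 - (2 * 1.034113459)⁻¹) < 2 * 1.034113459 := by
  have hexp : Real.exp (0.55060751906 ^ 2 / 2) ≤ 1.16367641891 :=
    (Real.exp_bound' (n := 9) (by norm_num) (by norm_num) (by norm_num)).trans (by
      norm_num [Finset.sum_range_succ, Nat.factorial])
  calc millsRatio (1.034113459 - (2 * 1.034113459)⁻¹)
      ≤ millsRatio 0.55060751906 := millsRatio_strictMono.monotone (by norm_num)
    _ ≤ Real.exp (0.55060751906 ^ 2 / 2) * √(Real.pi / 2) + millsSum (6 + 1) 0.55060751906 +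
          (1 + 1 / (2 * ((6 : ℕ) + 1))) * millsTerm (6 + 1) 0.55060751906 :=
        millsRatio_le_exp_mul_add_millsSum 6 (by norm_num) (by norm_num)
    _ ≤ 1.16367641891 * 1.2533141373156 + millsSum (6 + 1) 0.55060751906 +
          (1 + 1 / (2 * ((6 : ℕ) + 1))) * millsTerm (6 + 1) 0.55060751906 := by
        gcongr
        exact sqrt_pi_div_two_lt.le
    _ < 2 * 1.034113459 := by
        norm_num [millsSum, millsTerm, Finset.sum_range_succ, Nat.doubleFactorial]

theorem lt_millsRatio_at_upper_bound :
    2 * 1.034113460 < millsRatio (1.034113460 - (2 * 1.034113460)⁻¹) := by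
  have hexp : 1.16367641982 ≤ Real.exp (0.55060752052 ^ 2 / 2) :=
    le_trans (by norm_num [Finset.sum_range_succ, Nat.factorial])
      (Real.sum_le_exp_of_nonneg (by norm_num) 9)
  calc (2 * 1.034113460 : ℝ)
      < 1.16367641982 * 1.2533141373155 + millsSum (7 + 1) 0.55060752052 := by
        norm_num [millsSum, millsTerm, Finset.sum_range_succ, Nat.doubleFactorial]
    _ ≤ Real.exp (0.55060752052 ^ 2 / 2) * √(Real.pi / 2) + millsSum (7 + 1) 0.55060752052 := by
        gcongr
        exact lt_sqrt_pi_div_two.le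
    _ ≤ millsRatio 0.55060752052 := exp_mul_add_millsSum_le_millsRatio 7 (by norm_num)
    _ ≤ millsRatio (1.034113460 - (2 * 1.034113460)⁻¹) :=
        millsRatio_strictMono.monotone (by norm_num)

theorem exists_mul_cohenAInfty_eq_half :
    ∃ γ : ℝ, 1.034113459 ≤ γ ∧ γ < 1.034113460 ∧ γ * cohenAInfty γ = 1 / 2 := by
  have hlower : (1 / 2 : ℝ) < 1.034113459 * cohenAInfty 1.034113459 := by
    rw [← cmp_eq_lt_iff, ← cmp_millsRatio_sub_inv (by norm_num), cmp_eq_lt_iff]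
    exact millsRatio_lt_at_lower_bound
  have hupper : 1.034113460 * cohenAInfty 1.034113460 < (1 / 2 : ℝ) := by
    rw [← cmp_eq_gt_iff, ← cmp_millsRatio_sub_inv (by norm_num), cmp_eq_gt_iff]
    exact lt_millsRatio_at_upper_bound
  obtain ⟨δ, hδ⟩ : ∃ δ, truncNormalVarDrop δ = 1 / 2 := by
    rw [mul_cohenAInfty_eq_truncNormalVarDrop (by norm_num)] at hlower hupper
    have hcont : Continuous truncNormalVarDrop :=
      continuous_iff_continuousAt.2 fun δ ↦ (hasDerivAt_truncNormalVarDrop δ).continuousAt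
    exact mem_range_of_exists_le_of_exists_ge hcont ⟨_, hupper.le⟩ ⟨_, hlower.le⟩
  have hγ := truncNormalMean_pos δ
  have hhalf : truncNormalMean δ * cohenAInfty (truncNormalMean δ) = 1 / 2 :=
    (truncNormalMean_mul_cohenAInfty δ).trans hδ
  rw [← hhalf] at hlower hupper
  have hlower_pos : (0 : ℝ) < 1.034113459 := by norm_num
  have hupper_pos : (0 : ℝ) < 1.034113460 := by norm_num
  exact ⟨truncNormalMean δ, ((mul_cohenAInfty_strictAntiOn.lt_iff_gt hγ hlower_pos).1 hlower).le,
    (mul_cohenAInfty_strictAntiOn.lt_iff_gt hupper_pos hγ).1 hupper, hhalf⟩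

/-! ### The Halfin–Whitt limit -/

section HalfinWhitt

open MeasureTheory

variable {s : ℕ} {d δ v γ : ℝ}

theorem integral_pow_mul_exp_neg_mul_Ioi (k : ℕ) {p : ℝ} (hp : 0 < p) :
    ∫ v in Ioi (0 : ℝ), v ^ k * Real.exp (-(p * v)) = k.factorial / p ^ (k + 1) := by
  have hGamma := Real.integral_rpow_mul_exp_neg_mul_Ioi (a := (k : ℝ) + 1) (by positivity) hp
  simp only [add_sub_cancel_right, Real.rpow_natCast, Real.Gamma_nat_eq_factorial] at hGamma
  rw [hGamma, ← Nat.cast_add_one, Real.rpow_natCast, one_div, inv_pow, inv_mul_eq_div]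

theorem invErlangB_div_eq_integral (s : ℕ) {p : ℝ} (hp : 0 < p) (q : ℝ) :
    invErlangB s (p / q) =
      p * ∫ v in Ioi (0 : ℝ), Real.exp (-(p * v)) * (1 + q * v) ^ s := by
  have hbinom : ∀ v : ℝ, Real.exp (-(p * v)) * (1 + q * v) ^ s =
      ∑ k ∈ Finset.range (s + 1), s.choose k * q ^ k * (v ^ k * Real.exp (-(p * v))) := fun v ↦ by
    rw [add_comm 1, add_pow, Finset.mul_sum]
    refine Finset.sum_congr rfl fun k _ ↦ ?_
    rw [one_pow, mul_pow]
    ring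
  simp only [hbinom]
  rw [integral_finsetSum _ fun k _ ↦ (integrableOn_pow_mul_exp_neg_mul k hp).const_mul _,
    invErlangB_eq_sum_descFactorial, Finset.mul_sum]
  refine Finset.sum_congr rfl fun k _ ↦ ?_
  rw [integral_const_mul, integral_pow_mul_exp_neg_mul_Ioi k hp,
    Nat.descFactorial_eq_factorial_mul_choose, div_pow, div_div_eq_mul_div]
  push_cast
  field_simp
  ring

theorem sub_sq_div_two_le_log_one_add {x : ℝ} (hx : 0 ≤ x) :
    x - x ^ 2 / 2 ≤ Real.log (1 + x) := by
  refine le_trans ?_ (Real.le_log_one_add_of_nonneg hx)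
  rw [le_div_iff₀ (by positivity)]
  nlinarith [pow_nonneg hx 3]

theorem log_one_add_le_sub_sq_div {x : ℝ} (hx : 0 ≤ x) :
    Real.log (1 + x) ≤ x - x ^ 2 / (2 * (1 + x)) := by
  have hlog : 0 ≤ Real.log (1 + x) := Real.log_nonneg (by linarith)
  calc Real.log (1 + x) ≤ Real.sinh (Real.log (1 + x)) := Real.self_le_sinh_iff.2 hlog
    _ = (1 + x - (1 + x)⁻¹) / 2 := Real.sinh_log (by positivity)
    _ = x - x ^ 2 / (2 * (1 + x)) := by field_simp; ring

/-- The integrand representing the reciprocal of the Erlang B formula at the rate `s - d √s`, on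
the scale on which it converges as `s → ∞` with `d` fixed, see
`invErlangB_sub_mul_sqrt_eq_integral`. -/
noncomputable def halfinWhittIntegrand (s : ℕ) (d v : ℝ) : ℝ :=
  Real.exp (-((√(s : ℝ) - d) * v)) * (1 + (√(s : ℝ))⁻¹ * v) ^ s

theorem invErlangB_sub_mul_sqrt_eq_integral (hd : d < √(s : ℝ)) :
    invErlangB s (s - d * √(s : ℝ)) =
      (√(s : ℝ) - d) * ∫ v in Ioi (0 : ℝ), halfinWhittIntegrand s d v := by
  simp only [halfinWhittIntegrand]
  rw [← invErlangB_div_eq_integral s (sub_pos.2 hd), div_inv_eq_mul, sub_mul,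
    Real.mul_self_sqrt s.cast_nonneg]

theorem halfinWhittIntegrand_eq_exp (s : ℕ) (d : ℝ) (hv : 0 ≤ v) :
    halfinWhittIntegrand s d v =
      Real.exp (d * v - √(s : ℝ) * v + s * Real.log (1 + (√(s : ℝ))⁻¹ * v)) := by
  rw [halfinWhittIntegrand, Real.exp_add, Real.exp_nat_mul, Real.exp_log (by positivity)]
  ring_nf

theorem halfinWhittIntegrand_nonneg (s : ℕ) (d : ℝ) (hv : 0 ≤ v) :
    0 ≤ halfinWhittIntegrand s d v :=
  (halfinWhittIntegrand_eq_exp s d hv).symm ▸ (Real.exp_pos _).le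

theorem exp_le_halfinWhittIntegrand (hs : 1 ≤ s) (d : ℝ) (hv : 0 ≤ v) :
    Real.exp (d * v - v ^ 2 / 2) ≤ halfinWhittIntegrand s d v := by
  have := sqrt_natCast_pos hs
  rw [halfinWhittIntegrand_eq_exp s d hv, Real.exp_le_exp]
  calc d * v - v ^ 2 / 2
      = d * v - √(s : ℝ) * v + √(s : ℝ) ^ 2 *
          ((√(s : ℝ))⁻¹ * v - ((√(s : ℝ))⁻¹ * v) ^ 2 / 2) := by field_simp; ring
    _ ≤ d * v - √(s : ℝ) * v + s * Real.log (1 + (√(s : ℝ))⁻¹ * v) := by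
        rw [Real.sq_sqrt s.cast_nonneg]
        gcongr
        exact sub_sq_div_two_le_log_one_add (by positivity)

theorem halfinWhittIntegrand_le_exp (hs : 1 ≤ s) (d : ℝ) (hv : 0 ≤ v) :
    halfinWhittIntegrand s d v ≤
      Real.exp (d * v - v ^ 2 / (2 * (1 + (√(s : ℝ))⁻¹ * v))) := by
  have := sqrt_natCast_pos hs
  rw [halfinWhittIntegrand_eq_exp s d hv, Real.exp_le_exp]
  calc d * v - √(s : ℝ) * v + s * Real.log (1 + (√(s : ℝ))⁻¹ * v)
      ≤ d * v - √(s : ℝ) * v + √(s : ℝ) ^ 2 * ((√(s : ℝ))⁻¹ * v -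
          ((√(s : ℝ))⁻¹ * v) ^ 2 / (2 * (1 + (√(s : ℝ))⁻¹ * v))) := by
        rw [Real.sq_sqrt s.cast_nonneg]
        gcongr
        exact log_one_add_le_sub_sq_div (by positivity)
    _ = d * v - v ^ 2 / (2 * (1 + (√(s : ℝ))⁻¹ * v)) := by field_simp; ring

theorem halfinWhittIntegrand_le_exp_neg {b : ℝ} (hs : 1 ≤ s) (hb : 0 < b)
    (hbs : b ≤ √(s : ℝ)) (hd : d ≤ b / 2 - 1) (hv : 0 ≤ v) :
    halfinWhittIntegrand s d v ≤ Real.exp (b ^ 2 / 2) * Real.exp (-v) := by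
  refine (halfinWhittIntegrand_le_exp hs d hv).trans ?_
  rw [← Real.exp_add, Real.exp_le_exp]
  have hquad : b * (v - b) / 2 ≤ v ^ 2 / (2 * (1 + (√(s : ℝ))⁻¹ * v)) :=
    calc b * (v - b) / 2 ≤ v ^ 2 / (2 * (1 + b⁻¹ * v)) := by
          rw [le_div_iff₀ (by positivity)]
          have : b * (v - b) / 2 * (2 * (1 + b⁻¹ * v)) = v ^ 2 - b ^ 2 := by field_simp; ring
          linarith [sq_nonneg b]
      _ ≤ v ^ 2 / (2 * (1 + (√(s : ℝ))⁻¹ * v)) := by gcongr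
  have hdv : d * v ≤ (b / 2 - 1) * v := by gcongr
  linarith

theorem tendsto_sqrt_natCast : Tendsto (fun s : ℕ ↦ √(s : ℝ)) atTop atTop :=
  Real.tendsto_sqrt_atTop.comp tendsto_natCast_atTop_atTop

theorem tendsto_inv_sqrt_natCast : Tendsto (fun s : ℕ ↦ (√(s : ℝ))⁻¹) atTop (𝓝 0) :=
  tendsto_sqrt_natCast.inv_tendsto_atTop

theorem tendsto_halfinWhittIntegrand {d : ℕ → ℝ} (hd : Tendsto d atTop (𝓝 δ)) (hv : 0 ≤ v) :
    Tendsto (fun s ↦ halfinWhittIntegrand s (d s) v) atTop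
      (𝓝 (Real.exp (δ * v - v ^ 2 / 2))) := by
  have hlower : Tendsto (fun s ↦ Real.exp (d s * v - v ^ 2 / 2)) atTop
      (𝓝 (Real.exp (δ * v - v ^ 2 / 2))) := ((hd.mul_const v).sub_const _).rexp
  have hupper : Tendsto (fun s : ℕ ↦
      Real.exp (d s * v - v ^ 2 / (2 * (1 + (√(s : ℝ))⁻¹ * v)))) atTop
      (𝓝 (Real.exp (δ * v - v ^ 2 / 2))) := by
    have hden : Tendsto (fun s : ℕ ↦ 2 * (1 + (√(s : ℝ))⁻¹ * v)) atTop (𝓝 2) := by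
      simpa using ((tendsto_inv_sqrt_natCast.mul_const v).const_add 1).const_mul 2
    exact ((hd.mul_const v).sub (tendsto_const_nhds.div hden two_ne_zero)).rexp
  refine tendsto_of_tendsto_of_tendsto_of_le_of_le' hlower hupper ?_ ?_ <;>
    filter_upwards [eventually_ge_atTop 1] with s hs
  · exact exp_le_halfinWhittIntegrand hs (d s) hv
  · exact halfinWhittIntegrand_le_exp hs (d s) hv

theorem tendsto_integral_halfinWhittIntegrand {d : ℕ → ℝ} (hd : Tendsto d atTop (𝓝 δ)) :
    Tendsto (fun s ↦ ∫ v in Ioi (0 : ℝ), halfinWhittIntegrand s (d s) v) atTop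
      (𝓝 (millsRatio δ)) := by
  obtain ⟨b, hb, hδb⟩ : ∃ b : ℝ, 0 < b ∧ δ < b / 2 - 1 :=
    ⟨2 * (|δ| + 2), by positivity, by linarith [le_abs_self δ]⟩
  rw [millsRatio, millsMoment]
  refine tendsto_integral_filter_of_dominated_convergence
    (fun v ↦ Real.exp (b ^ 2 / 2) * Real.exp (-v)) ?_ ?_
    (integrableOn_exp_neg_Ioi 0 |>.const_mul _) ?_
  · refine Eventually.of_forall fun s ↦ Continuous.aestronglyMeasurable ?_
    unfold halfinWhittIntegrand
    fun_prop
  · filter_upwards [eventually_ge_atTop 1, tendsto_sqrt_natCast.eventually_ge_atTop b,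
      hd.eventually_le_const hδb] with s hs hbs hdb
    filter_upwards [ae_restrict_mem measurableSet_Ioi] with v (hv : 0 < v)
    rw [Real.norm_of_nonneg (halfinWhittIntegrand_nonneg s (d s) hv.le)]
    exact halfinWhittIntegrand_le_exp_neg hs hb hbs hdb hv.le
  · filter_upwards [ae_restrict_mem measurableSet_Ioi] with v (hv : 0 < v)
    simpa only [pow_zero, one_mul] using tendsto_halfinWhittIntegrand hd hv.le

theorem tendsto_invErlangB_div_sqrt {d : ℕ → ℝ} (hd : Tendsto d atTop (𝓝 δ)) :
    Tendsto (fun s : ℕ ↦ invErlangB s (s - d s * √(s : ℝ)) / √(s : ℝ)) atTop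
      (𝓝 (millsRatio δ)) := by
  have hfactor : Tendsto (fun s : ℕ ↦ 1 - d s * (√(s : ℝ))⁻¹) atTop (𝓝 1) := by
    simpa using (hd.mul tendsto_inv_sqrt_natCast).const_sub 1
  have hlim := hfactor.mul (tendsto_integral_halfinWhittIntegrand hd)
  rw [one_mul] at hlim
  refine hlim.congr' ?_
  filter_upwards [eventually_ge_atTop 1, hd.eventually_lt_const (lt_add_one δ),
    tendsto_sqrt_natCast.eventually_ge_atTop (δ + 1)] with s hs hdδ hδs
  have := sqrt_natCast_pos hs
  rw [invErlangB_sub_mul_sqrt_eq_integral (hdδ.trans_le hδs)]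
  field_simp

theorem criticalRate_mul_sqrt (hs : 1 ≤ s) (hγ : γ ≠ 0) :
    criticalRate s (γ * √(s : ℝ)) =
      s - (γ - (2 * γ)⁻¹ + (2 * √(s : ℝ))⁻¹) * √(s : ℝ) := by
  have hσ := sqrt_natCast_pos hs
  have hsq : (s : ℝ) = √(s : ℝ) ^ 2 := (Real.sq_sqrt s.cast_nonneg).symm
  rw [criticalRate]
  field_simp
  rw [hsq, Real.sqrt_sq hσ.le]
  ring

theorem tendsto_invErlangB_criticalRate_div_sqrt (hγ : γ ≠ 0) :
    Tendsto (fun s : ℕ ↦ invErlangB s (criticalRate s (γ * √(s : ℝ))) / √(s : ℝ)) atTop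
      (𝓝 (millsRatio (γ - (2 * γ)⁻¹))) := by
  have hd : Tendsto (fun s : ℕ ↦ γ - (2 * γ)⁻¹ + (2 * √(s : ℝ))⁻¹) atTop
      (𝓝 (γ - (2 * γ)⁻¹)) := by
    simpa [mul_comm] using (tendsto_inv_sqrt_natCast.mul_const 2⁻¹).const_add (γ - (2 * γ)⁻¹)
  refine (tendsto_invErlangB_div_sqrt hd).congr' ?_
  filter_upwards [eventually_ge_atTop 1] with s hs
  rw [criticalRate_mul_sqrt hs hγ]

theorem eventually_lt_gammaHat (hγ : 0 < γ) (h : 1 / 2 < γ * cohenAInfty γ) :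
    ∀ᶠ s in atTop, γ < gammaHat s := by
  have hlt : millsRatio (γ - (2 * γ)⁻¹) < 2 * γ := by
    rwa [← cmp_eq_lt_iff, cmp_millsRatio_sub_inv hγ, cmp_eq_lt_iff]
  filter_upwards [eventually_ge_atTop 1, tendsto_sqrt_natCast.eventually_gt_atTop γ,
    (tendsto_invErlangB_criticalRate_div_sqrt hγ.ne').eventually_lt_const hlt] with s hs hγs hR
  rw [div_lt_iff₀ (hγ.trans hγs)] at hR
  rw [lt_gammaHat_iff hs ⟨hγ, hγs⟩]
  linarith

theorem eventually_gammaHat_lt (hγ : 0 < γ) (h : γ * cohenAInfty γ < 1 / 2) :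
    ∀ᶠ s in atTop, gammaHat s < γ := by
  have hlt : 2 * γ < millsRatio (γ - (2 * γ)⁻¹) := by
    rwa [← cmp_eq_gt_iff, cmp_millsRatio_sub_inv hγ, cmp_eq_gt_iff]
  have hlower : Tendsto (fun s : ℕ ↦ (√(s : ℝ))⁻¹ + 2 * γ) atTop (𝓝 (2 * γ)) := by
    simpa using tendsto_inv_sqrt_natCast.add_const (2 * γ)
  filter_upwards [eventually_ge_atTop 1, tendsto_sqrt_natCast.eventually_gt_atTop γ,
    hlower.eventually_lt (tendsto_invErlangB_criticalRate_div_sqrt hγ.ne') hlt] with s hs hγs hR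
  have hσ : 0 < √(s : ℝ) := hγ.trans hγs
  rw [lt_div_iff₀ hσ, add_mul, inv_mul_cancel₀ hσ.ne'] at hR
  rw [gammaHat_lt_iff hs ⟨hγ, hγs⟩]
  linarith

theorem tendsto_gammaHat (hγ : 0 < γ) (h : γ * cohenAInfty γ = 1 / 2) :
    Tendsto gammaHat atTop (𝓝 γ) := by
  refine tendsto_order.2 ⟨fun x hx ↦ ?_, fun x hx ↦ ?_⟩
  · rcases le_or_gt x 0 with hx0 | hx0
    · filter_upwards [eventually_ge_atTop 1] with s hs
      exact hx0.trans_lt (gammaHat_mem_Ioo hs).1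
    · exact eventually_lt_gammaHat hx0 (h ▸ mul_cohenAInfty_strictAntiOn hx0 hγ hx)
  · have hx0 : 0 < x := hγ.trans hx
    exact eventually_gammaHat_lt hx0 (h ▸ mul_cohenAInfty_strictAntiOn hγ hx0 hx)

end HalfinWhitt

/-- The first three clauses say that `a_s(γ)`, `a_∞(γ)` and `γ̂_s` are well defined. -/
theorem mainTheorem10 :
    (∀ s : ℕ, 1 ≤ s → ∀ γ ∈ Ioo (0 : ℝ) (√(s : ℝ)), ∃! a : ℝ, IsCohenSol s γ a) ∧
    (∀ γ : ℝ, 0 < γ → ∃! a : ℝ, a = fInfty (γ - a)) ∧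
    (∀ s : ℕ, 1 ≤ s → ∃! γ : ℝ, IsMaximizerL s γ) ∧
    StrictMonoOn gammaHat (Ici 1) ∧
    gammaHat 1 = 1 / 2 ∧
    StrictAntiOn (fun γ : ℝ => γ * cohenAInfty γ) (Ioi 0) ∧
    Tendsto (fun γ : ℝ => γ * cohenAInfty γ) (𝓝[>] 0) (𝓝 1) ∧
    Tendsto (fun γ : ℝ => γ * cohenAInfty γ) atTop (𝓝 0) ∧
    ∃ γinf : ℝ,
      (0 < γinf ∧ γinf * cohenAInfty γinf = 1 / 2) ∧
      (∀ γ : ℝ, 0 < γ → γ * cohenAInfty γ = 1 / 2 → γ = γinf) ∧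
      Tendsto gammaHat atTop (𝓝 γinf) ∧
      (1.034113459 : ℝ) ≤ γinf ∧ γinf < (1.034113460 : ℝ) := by
  obtain ⟨γinf, hlo, hhi, hhalf⟩ := exists_mul_cohenAInfty_eq_half
  have hpos : 0 < γinf := by linarith
  exact ⟨fun s hs γ hγ ↦ existsUnique_isCohenSol hs hγ, fun γ hγ ↦ existsUnique_eq_fInfty_sub hγ,
    fun s hs ↦ existsUnique_isMaximizerL hs, gammaHat_strictMonoOn, gammaHat_one,
    mul_cohenAInfty_strictAntiOn, tendsto_mul_cohenAInfty_zero, tendsto_mul_cohenAInfty_atTop,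
    γinf, ⟨hpos, hhalf⟩,
    fun γ hγ he ↦ mul_cohenAInfty_strictAntiOn.injOn hγ hpos (he.trans hhalf.symm),
    tendsto_gammaHat hpos hhalf, hlo, hhi⟩
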